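/- Let $c\ge 0$ be a real number and let $(m_n)_{n\ge1}$ be nonnegative integers with $2m_n/n\to c$ (for instance $m_n=\lfloor nc/2\rfloor$, so that $m_n=nc/2$ whenever this is an integer). For $n\ge 1$ and $m_n\le\binom n2$ (which holds for all large $n$) let $z$ be the Erdős–Rényi graph $\mathcal G([n],m_n)$, that is, a uniformly distributed element of the set of simple graphs on $[n]=\{1,\dots,n\}$ with exactly $m_n$ edges; write $\mathbb Q_n$ for its law and $D_z=\frac1n\sum_{i=1}^n\delta_{\deg_z(i)}$ for its degree distribution, a probability measure on $\mathbb N_0=\{0,1,2,\dots\}$. Let $\mathcal L(\mathbb N_0)$ be the set of probability measures on $\mathbb N_0$ with the weak topology, let $q_c$ be the Poisson distribution with mean $c$ ($q_0=\delta_0$), and let $H(p\,\|\,q_c)=\sum_k p(k)\log\frac{p(k)}{q_c(k)}\in[0,\infty]$ be the relative entropy. Put $$I_c(p)=\begin{cases}H(p\,\|\,q_c)&\text{if }\sum_{k} k\,p(k)=c,\\ \infty&\text{otherwise.}\end{cases}$$ Then $D_z$ satisfies a large deviation principle with speed $n$ and rate function $I_c$: the function $I_c:\mathcal L(\mathbb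 N_0)\to[0,\infty]$ is lower semicontinuous, and for every subset $\Gamma\subseteq\mathcal L(\mathbb N_0)$, $$-\inf_{p\in\operatorname{int}(\Gamma)}I_c(p)\le\liminf_{n\to\infty}\frac1n\log\mathbb Q_n\{D_z\in\Gamma\}\le\limsup_{n\to\infty}\frac1n\log\mathbb Q_n\{D_z\in\Gamma\}\le-\inf_{p\in\operatorname{cl}(\Gamma)}I_c(p),$$ where $\log 0=-\infty$ and $\inf\emptyset=\infty$. -/

import Mathlib

open MeasureTheory Filter Topology
open scoped NNReal ENNReal

noncomputable section

namespace ERDegree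

/-- The degree distribution `(1/|V|) ∑ᵥ δ_{deg v}` of a finite simple graph, as a measure on `ℕ`. -/
def degreeDistribution {V : Type*} [Fintype V] (G : SimpleGraph V) : Measure ℕ :=
  open Classical in
  (Fintype.card V : ℝ≥0∞)⁻¹ • ∑ v : V, Measure.dirac (G.degree v)

instance isProbabilityMeasure_degreeDistribution {V : Type*} [Fintype V] [Nonempty V]
    (G : SimpleGraph V) : IsProbabilityMeasure (degreeDistribution G) := by
  constructor
  simp only [degreeDistribution, Measure.smul_apply, Measure.coe_finsetSum, Finset.sum_apply,
    measure_univ, Finset.sum_const, Finset.card_univ, nsmul_eq_mul, mul_one, smul_eq_mul]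
  exact ENNReal.inv_mul_cancel (by simp) (by simp)

/-- The simple graphs on the vertex set `Fin n` that have exactly `m` edges. -/
def graphsWithEdges (n m : ℕ) : Set (SimpleGraph (Fin n)) :=
  {G | G.edgeSet.ncard = m}

/-- The probability that a uniformly distributed simple graph with `n` vertices and `m` edges
has its degree distribution in `Γ`. -/
def probDegreeDistributionMem (n m : ℕ) (Γ : Set (ProbabilityMeasure ℕ)) : ℝ≥0∞ :=
  ({G ∈ graphsWithEdges n m | ∃ p ∈ Γ, (p : Measure ℕ) = degreeDistribution G}.ncard : ℝ≥0∞) /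
    ((graphsWithEdges n m).ncard : ℝ≥0∞)

/-- The rate function: the relative entropy with respect to the Poisson law of mean `c` for
probability measures on `ℕ` of mean `c`, and `∞` for all the others. -/
def rate (c : ℝ≥0) (p : ProbabilityMeasure ℕ) : ℝ≥0∞ :=
  open Classical in
  if ∫⁻ k : ℕ, (k : ℝ≥0∞) ∂(p : Measure ℕ) = (c : ℝ≥0∞) then
    InformationTheory.klDiv (p : Measure ℕ) (ProbabilityTheory.poissonMeasure c)
  else ∞

end ERDegree

end

/-! Listing the edges of a graph with `m` edges in some order, each with an orientation, gives `m! *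
2 ^ m` simple sequences of `m` ordered pairs, so the probability is a ratio of counts of such
sequences. If loops and repetitions are allowed, the number of sequences with degrees `d` is the
multinomial `(2m)! / ∏ (d i)!`. By `arrangements_eq_prod_poissonMeasure` this is `∏ q_c(d i)` times
a factor depending only on `n` and `m`: up to simplicity, the degrees are independent Poisson
variables conditioned on their sum. Since `m = O(n)`, the number of all simple sequences is `n ^
(2m)` up to a factor `exp (o(n))`, and Stirling shows that the normalisation contributes nothing at
speed `n`.

Upper bound: simplicity is dropped. By the method of types (`sum_prod_poissonMeasure_le`) each
histogram has Poisson weight at most `exp (-n H)`, and only `exp (O(√n log n))` histograms have sum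
`2m`. The mean is not weakly continuous, but all exponential moments of the Poisson law are finite,
so the mean is continuous on entropy sublevel sets, which are compact (`continuousOn_firstMoment`,
`isCompact_entropySublevel`). Hence laws of mean `2m/n → c` can be compared with laws of mean `c`
(`limsup_le_neg_of_lt`).

Lower bound: a bounded degree sequence has to be realised by simple sequences without exponential
loss. All but the last `J ≈ √n` pairs are simple for a proportion `exp (-O(√n))` of the arrangements
(`le_ncard_isSimpleSeq_endpointCount`). The last `J` pairs are replaced by fresh edges, at a cost `n
^ (2J) = exp (o(n))` and a change of at most `4J` in each histogram entry
(`ncard_le_mul_ncard_patched`, `abs_histogram_sub_le`). A general law of mean `c` and finite entropy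
is first mixed with the Poisson law, so that it charges `0` and `1`, and then truncated, with the
lost mean and mass put back at `1` and `0`.

For `c = 0` the Poisson law is degenerate, and the degree distribution converges to `δ_0`
deterministically. -/

noncomputable section

namespace ERDegree

/-! ### Weak convergence on `ℕ` through point masses -/

section WeakTopology

/-- Every subset of `ℕ` is a union of singletons, and singletons with the empty set are closed under
intersection. No mass can escape because the limit is itself a probability measure. -/
theorem tendsto_of_tendsto_singleton {ι : Type*} {l : Filter ι} [l.IsCountablyGenerated]
    {μ : ι → ProbabilityMeasure ℕ} {p : ProbabilityMeasure ℕ}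
    (h : ∀ k, Tendsto (fun i => (μ i : Measure ℕ).real {k}) l (𝓝 ((p : Measure ℕ).real {k}))) :
    Tendsto μ l (𝓝 p) := by
  refine IsPiSystem.tendsto_probabilityMeasure_of_tendsto_of_mem
    (S := Set.range (fun k : ℕ => ({k} : Set ℕ))) ?_ ?_ ?_ ?_
  · rintro _ ⟨a, rfl⟩ _ ⟨b, rfl⟩ ⟨x, hx⟩
    simp only [Set.mem_inter_iff, Set.mem_singleton_iff] at hx
    exact ⟨a, by ext y; simp; omega⟩
  · rintro _ ⟨a, rfl⟩
    exact measurableSet_singleton a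
  · exact fun u _ x hx => ⟨{x}, ⟨x, rfl⟩, by simp, by simpa using hx⟩
  · rintro _ ⟨k, rfl⟩
    have := h k
    simp only [ProbabilityMeasure.measureReal_eq_coe_coeFn] at this
    exact_mod_cast this

/-- Otherwise there would be laws outside `U` that agree with `p` ever more closely on ever more
coordinates, and these would converge to `p`. -/
theorem exists_coordinates_of_mem_nhds {p : ProbabilityMeasure ℕ} {U : Set (ProbabilityMeasure ℕ)}
    (hU : U ∈ 𝓝 p) : ∃ K : ℕ, ∃ δ > 0, ∀ ν : ProbabilityMeasure ℕ,
      (∀ k < K, |(ν : Measure ℕ).real {k} - (p : Measure ℕ).real {k}| < δ) → ν ∈ U := by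
  by_contra! hcon
  have h1 : ∀ j : ℕ, ∃ ν : ProbabilityMeasure ℕ, (∀ k < j,
      |(ν : Measure ℕ).real {k} - (p : Measure ℕ).real {k}| < 1 / ((j : ℝ) + 1)) ∧ ν ∉ U :=
    fun j => hcon j (1 / ((j : ℝ) + 1)) (by positivity)
  choose ν hν hνU using h1
  have : Tendsto ν atTop (𝓝 p) := by
    refine tendsto_of_tendsto_singleton fun k => ?_
    rw [tendsto_iff_norm_sub_tendsto_zero]
    refine squeeze_zero' (Eventually.of_forall fun _ => norm_nonneg _) ?_
      tendsto_one_div_add_atTop_nhds_zero_nat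
    filter_upwards [eventually_gt_atTop k] with j hj
    exact (hν j k hj).le
  obtain ⟨j, hj⟩ := (this.eventually hU).exists
  exact hνU j hj

theorem continuous_measure_singleton (k : ℕ) :
    Continuous fun p : ProbabilityMeasure ℕ => (p : Measure ℕ) {k} := by
  rw [continuous_iff_continuousAt]
  intro p
  have := ProbabilityMeasure.tendsto_measure_of_isClopen_of_tendsto (μs := id) (μ := p)
    tendsto_id (isClopen_discrete ({k} : Set ℕ))
  have h2 := ENNReal.tendsto_coe.2 this
  simpa [ContinuousAt] using h2

theorem continuous_real_singleton (k : ℕ) :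
    Continuous fun p : ProbabilityMeasure ℕ => (p : Measure ℕ).real {k} := by
  rw [continuous_iff_continuousAt]
  intro p
  exact (ENNReal.tendsto_toReal (measure_ne_top _ _)).comp
    (continuous_measure_singleton k).continuousAt

end WeakTopology

/-! ### Relative entropy to a Poisson law, continuity of the mean, and lower semicontinuity of the
rate -/

section Entropy

open InformationTheory ProbabilityTheory

variable {c : ℝ≥0}

theorem absolutelyContinuous_poissonMeasure (hc : 0 < c) (p : Measure ℕ) :
    p ≪ poissonMeasure c := by
  refine Measure.AbsolutelyContinuous.mk fun s _ hs => ?_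
  have : s = ∅ := by
    by_contra hne
    obtain ⟨k, hk⟩ := Set.nonempty_iff_ne_empty.2 hne
    have h0 : poissonMeasure c {k} = 0 := measure_mono_null (by simpa using hk) hs
    have := poissonMeasure_real_singleton_pos (r := c) k hc
    simp [measureReal_def, h0] at this
  simp [this]

theorem toReal_rnDeriv_poissonMeasure (hc : 0 < c) (p : Measure ℕ) [IsFiniteMeasure p] (k : ℕ) :
    (p.rnDeriv (poissonMeasure c) k).toReal = p.real {k} / (poissonMeasure c).real {k} := by
  have hq := poissonMeasure_real_singleton_pos (r := c) k hc
  have h := Measure.withDensity_rnDeriv_eq p (poissonMeasure c)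
    (absolutelyContinuous_poissonMeasure hc p)
  have h2 : p {k} = p.rnDeriv (poissonMeasure c) k * poissonMeasure c {k} := by
    conv_lhs => rw [← h]
    rw [withDensity_apply _ (measurableSet_singleton k)]
    simp [mul_comm]
  rw [eq_div_iff hq.ne', measureReal_def, measureReal_def, h2, ENNReal.toReal_mul]

/-- Writing the entropy with `klFun x = x log x + 1 - x` makes every summand nonnegative and
continuous in the point mass. Semicontinuity, convexity and tail estimates can then be done term by
term. -/
theorem klDiv_poissonMeasure (hc : 0 < c) (p : Measure ℕ) [IsFiniteMeasure p] :
    klDiv p (poissonMeasure c) = ∑' k, ENNReal.ofReal ((poissonMeasure c).real {k} *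
      klFun (p.real {k} / (poissonMeasure c).real {k})) := by
  rw [klDiv_eq_lintegral_klFun_of_ac (absolutelyContinuous_poissonMeasure hc p),
    lintegral_countable']
  refine tsum_congr fun k => ?_
  rw [toReal_rnDeriv_poissonMeasure hc, mul_comm, ENNReal.ofReal_mul measureReal_nonneg,
    ofReal_measureReal]

theorem lowerSemicontinuous_klDiv (hc : 0 < c) :
    LowerSemicontinuous fun p : ProbabilityMeasure ℕ =>
      klDiv (p : Measure ℕ) (poissonMeasure c) := by
  simp_rw [klDiv_poissonMeasure hc]
  refine lowerSemicontinuous_tsum fun k => Continuous.lowerSemicontinuous ?_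
  refine ENNReal.continuous_ofReal.comp (continuous_const.mul (continuous_klFun.comp ?_))
  exact (continuous_real_singleton k).div_const _

/-- Young's inequality for the function `klFun`. -/
theorem mul_le_mul_klFun_add {q x : ℝ} (hq : 0 < q) (hx : 0 ≤ x) (t : ℝ) :
    x * t ≤ q * klFun (x / q) + q * Real.exp t := by
  rcases hx.eq_or_lt with rfl | hx
  · simp [klFun_zero]; positivity
  · have h := Real.add_one_le_exp (t - Real.log (x / q))
    rw [Real.exp_sub, Real.exp_log (by positivity)] at h
    have h2 := mul_le_mul_of_nonneg_left h hx.le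
    have h3 : x * (Real.exp t / (x / q)) = q * Real.exp t := by field_simp
    rw [h3] at h2
    rw [klFun_apply]
    have h4 : q * (x / q * Real.log (x / q) + 1 - x / q) = x * Real.log (x / q) + q - x := by
      field_simp
    rw [h4]
    nlinarith

theorem tsum_poissonMeasure_mul_exp_ne_top (c : ℝ≥0) (θ : ℝ) :
    ∑' k : ℕ, ENNReal.ofReal ((poissonMeasure c).real {k} * Real.exp (θ * k)) ≠ ∞ := by
  have h : Summable fun k : ℕ => (poissonMeasure c).real {k} * Real.exp (θ * k) := by
    have := (Real.summable_pow_div_factorial (c * Real.exp θ)).mul_left (Real.exp (-c))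
    refine this.congr fun k => ?_
    rw [poissonMeasure_real_singleton, mul_pow, ← Real.exp_nat_mul, mul_comm θ]
    ring
  exact h.tsum_ofReal_ne_top

theorem klFun_term_nonneg (p : Measure ℕ) (k : ℕ) :
    0 ≤ (poissonMeasure c).real {k} * klFun (p.real {k} / (poissonMeasure c).real {k}) := by
  have := klFun_nonneg (x := p.real {k} / (poissonMeasure c).real {k}) (by positivity)
  positivity

/-- The first moment is uniformly integrable on the sublevel sets of the relative entropy. -/
theorem exists_tail_le (hc : 0 < c) (a : ℝ≥0) {ε : ℝ≥0} (hε : 0 < ε) :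
    ∃ K : ℕ, ∀ p : ProbabilityMeasure ℕ, klDiv (p : Measure ℕ) (poissonMeasure c) ≤ a →
      ∑' k, (if K ≤ k then (k : ℝ≥0∞) * (p : Measure ℕ) {k} else 0) ≤ ε := by
  -- Young's inequality with slope `θ` bounds `θ` times the tail by the entropy, at most `a`, plus
  -- an exponential Poisson tail, made at most `1` by the choice of `K`. Hence `θ * ε = a + 1`.
  set θ : ℝ≥0 := (a + 1) / ε with hθ
  have hθ0 : 0 < θ := by positivity
  obtain ⟨K, hK⟩ : ∃ K : ℕ, ∑' k : ℕ, (if K ≤ k then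
      ENNReal.ofReal ((poissonMeasure c).real {k} * Real.exp (θ * k)) else 0) ≤ 1 := by
    have h := ENNReal.tendsto_sum_nat_add
      (fun k : ℕ => ENNReal.ofReal ((poissonMeasure c).real {k} * Real.exp (θ * k)))
      (tsum_poissonMeasure_mul_exp_ne_top c θ)
    obtain ⟨K, hK⟩ := (h.eventually (Iic_mem_nhds (zero_lt_one (α := ℝ≥0∞)))).exists
    refine ⟨K, le_trans (le_of_eq ?_) hK⟩
    rw [← (ENNReal.summable).sum_add_tsum_nat_add' (k := K)]
    rw [Finset.sum_eq_zero, zero_add]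
    · refine tsum_congr fun k => ?_
      simp
    · intro i hi
      simp [Finset.mem_range.1 hi]
  refine ⟨K, fun p hp => ?_⟩
  have key : (θ : ℝ≥0∞) * ∑' k, (if K ≤ k then (k : ℝ≥0∞) * (p : Measure ℕ) {k} else 0) ≤
      a + 1 := by
    rw [← ENNReal.tsum_mul_left]
    calc ∑' k : ℕ, (θ : ℝ≥0∞) * (if K ≤ k then (k : ℝ≥0∞) * (p : Measure ℕ) {k} else 0)
        ≤ ∑' k : ℕ, (ENNReal.ofReal ((poissonMeasure c).real {k} *
            klFun ((p : Measure ℕ).real {k} / (poissonMeasure c).real {k})) + (if K ≤ k then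
          ENNReal.ofReal ((poissonMeasure c).real {k} * Real.exp (θ * k)) else 0)) := by
          refine ENNReal.tsum_le_tsum fun k => ?_
          split_ifs
          · rw [← ENNReal.ofReal_add (klFun_term_nonneg _ _) (by positivity)]
            have h := mul_le_mul_klFun_add (poissonMeasure_real_singleton_pos (r := c) k hc)
              (measureReal_nonneg (μ := (p : Measure ℕ)) (s := {k})) (θ * k)
            refine le_trans (le_of_eq ?_) (ENNReal.ofReal_le_ofReal h)
            rw [ENNReal.ofReal_mul measureReal_nonneg, ENNReal.ofReal_mul (NNReal.coe_nonneg θ),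
              ofReal_measureReal,
              ENNReal.ofReal_natCast, ENNReal.ofReal_coe_nnreal]
            ring
          · simp
      _ ≤ a + 1 := by
          rw [ENNReal.tsum_add]
          rw [klDiv_poissonMeasure hc] at hp
          exact add_le_add hp hK
  have : ((a : ℝ≥0∞) + 1) = θ * ε := by
    have : a + 1 = θ * ε := by rw [hθ]; field_simp
    exact_mod_cast this
  rw [this] at key
  exact (ENNReal.mul_le_mul_iff_right (by exact_mod_cast hθ0.ne') ENNReal.coe_ne_top).1 key

/-- The first moment of a measure on `ℕ`. -/
def firstMoment (p : ProbabilityMeasure ℕ) : ℝ≥0∞ := ∑' k : ℕ, (k : ℝ≥0∞) * (p : Measure ℕ) {k}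

theorem lintegral_natCast_eq_firstMoment (p : ProbabilityMeasure ℕ) :
    ∫⁻ k : ℕ, (k : ℝ≥0∞) ∂(p : Measure ℕ) = firstMoment p :=
  lintegral_countable' _

theorem firstMoment_eq_sum_add (p : ProbabilityMeasure ℕ) (K : ℕ) :
    firstMoment p = ∑ k ∈ Finset.range K, (k : ℝ≥0∞) * (p : Measure ℕ) {k} +
      ∑' k, (if K ≤ k then (k : ℝ≥0∞) * (p : Measure ℕ) {k} else 0) := by
  rw [firstMoment, ← (ENNReal.summable).sum_add_tsum_nat_add' (k := K)]
  congr 1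
  rw [← (ENNReal.summable).sum_add_tsum_nat_add' (k := K) (f := fun k => if K ≤ k then _ else _)]
  rw [Finset.sum_eq_zero, zero_add]
  · simp
  · intro i hi
    simp [Finset.mem_range.1 hi]

theorem continuous_sum_range_mul (K : ℕ) : Continuous fun p : ProbabilityMeasure ℕ =>
    ∑ k ∈ Finset.range K, (k : ℝ≥0∞) * (p : Measure ℕ) {k} :=
  continuous_finsetSum _ fun k _ =>
    (ENNReal.continuous_const_mul (ENNReal.natCast_ne_top k)).comp (continuous_measure_singleton k)

theorem lowerSemicontinuous_firstMoment : LowerSemicontinuous firstMoment := by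
  refine lowerSemicontinuous_tsum fun k => Continuous.lowerSemicontinuous ?_
  exact (ENNReal.continuous_const_mul (ENNReal.natCast_ne_top k)).comp
    (continuous_measure_singleton k)

/-- The sublevel sets of the relative entropy with respect to a Poisson law. -/
def entropySublevel (c a : ℝ≥0) : Set (ProbabilityMeasure ℕ) :=
  {p | klDiv (p : Measure ℕ) (poissonMeasure c) ≤ a}

/-- On the whole space the mean is only lower semicontinuous, since mass may drift to infinity. The
uniform tail bound supplies the other half, which keeps the constraint on the mean under weak limits
of bounded entropy. -/
theorem continuousOn_firstMoment (hc : 0 < c) (a : ℝ≥0) :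
    ContinuousOn firstMoment (entropySublevel c a) := by
  intro p _
  refine tendsto_order.2 ⟨fun b hb => ?_, fun b hb => ?_⟩
  · exact mem_nhdsWithin_of_mem_nhds (lowerSemicontinuous_firstMoment p b hb)
  · obtain ⟨ε, hε, hεb⟩ : ∃ ε : ℝ≥0, 0 < ε ∧ firstMoment p + ε < b := by
      obtain ⟨ε, hε, h⟩ := ENNReal.lt_iff_exists_add_pos_lt.1 hb
      exact ⟨ε, hε, h⟩
    obtain ⟨K, hK⟩ := exists_tail_le hc a hε
    have h1 : ∑ k ∈ Finset.range K, (k : ℝ≥0∞) * (p : Measure ℕ) {k} + ε < b := by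
      refine lt_of_le_of_lt ?_ hεb
      rw [firstMoment_eq_sum_add p K]
      gcongr
      exact le_self_add
    have h2 := ((continuous_sum_range_mul K).add (continuous_const (y := (ε : ℝ≥0∞)))).continuousAt
      (x := p) |>.eventually (Iio_mem_nhds h1)
    filter_upwards [mem_nhdsWithin_of_mem_nhds h2, self_mem_nhdsWithin] with r hr hra
    refine lt_of_le_of_lt ?_ hr
    rw [firstMoment_eq_sum_add r K]
    exact add_le_add le_rfl (hK r hra)

theorem isClosed_entropySublevel (hc : 0 < c) (a : ℝ≥0) : IsClosed (entropySublevel c a) :=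
  (lowerSemicontinuous_klDiv hc).isClosed_preimage (a : ℝ≥0∞)

/-- Prokhorov: beyond `K` each point satisfies `k ≥ 1`, so the mass there is at most the tail of the
first moment, which is uniformly small. -/
theorem isCompact_entropySublevel (hc : 0 < c) (a : ℝ≥0) : IsCompact (entropySublevel c a) := by
  rw [← (isClosed_entropySublevel hc a).closure_eq]
  refine isCompact_closure_of_isTightMeasureSet ?_
  rw [isTightMeasureSet_iff_exists_isCompact_measure_compl_le]
  intro ε hε
  obtain ⟨ε', hε', hle⟩ := ENNReal.lt_iff_exists_nnreal_btwn.1 hε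
  obtain ⟨K, hK⟩ := exists_tail_le hc a (ε := ε') (by exact_mod_cast hε')
  refine ⟨Set.Iic K, (Set.finite_Iic K).isCompact, ?_⟩
  rintro _ ⟨p, hp, rfl⟩
  refine le_trans ?_ hle.le
  refine le_trans ?_ (hK p hp)
  rw [← lintegral_indicator_one (by measurability), lintegral_countable']
  refine ENNReal.tsum_le_tsum fun k => ?_
  by_cases hk : K < k
  · simp only [Set.indicator, Set.mem_compl_iff, Set.mem_Iic, not_le, hk, if_true, Pi.one_apply,
      one_mul, hk.le]
    refine le_mul_of_one_le_left (by simp) ?_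
    exact_mod_cast (by omega : 1 ≤ k)
  · simp [Set.indicator, hk]

theorem rate_of_eq {p : ProbabilityMeasure ℕ} (h : firstMoment p = c) :
    rate c p = klDiv (p : Measure ℕ) (poissonMeasure c) := by
  rw [rate, lintegral_natCast_eq_firstMoment, if_pos h]

theorem rate_of_ne {p : ProbabilityMeasure ℕ} (h : firstMoment p ≠ c) : rate c p = ∞ := by
  rw [rate, lintegral_natCast_eq_firstMoment, if_neg h]

theorem setOf_rate_le (c a : ℝ≥0) :
    {p | rate c p ≤ a} = entropySublevel c a ∩ firstMoment ⁻¹' {(c : ℝ≥0∞)} := by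
  ext p
  by_cases h : firstMoment p = c
  · simp [rate_of_eq h, h, entropySublevel]
  · simp [rate_of_ne h, h]

theorem lowerSemicontinuous_of_isClosed_coe {X : Type*} [TopologicalSpace X] {f : X → ℝ≥0∞}
    (h : ∀ a : ℝ≥0, IsClosed {x | f x ≤ a}) : LowerSemicontinuous f := by
  rw [lowerSemicontinuous_iff_isClosed_preimage]
  intro y
  induction y with
  | top => simp
  | coe a => exact h a

theorem lowerSemicontinuous_rate_of_pos (hc : 0 < c) : LowerSemicontinuous (rate c) := by
  refine lowerSemicontinuous_of_isClosed_coe fun a => ?_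
  rw [setOf_rate_le]
  exact (continuousOn_firstMoment hc a).preimage_isClosed_of_isClosed
    (isClosed_entropySublevel hc a) isClosed_singleton

/-- The point mass at `0`. -/
def diracZero : ProbabilityMeasure ℕ := ⟨Measure.dirac 0, inferInstance⟩

theorem poissonMeasure_zero : poissonMeasure 0 = Measure.dirac 0 := by
  refine Measure.ext_of_singleton fun k => ?_
  rw [poissonMeasure_singleton]
  rcases Nat.eq_zero_or_pos k with rfl | hk
  · simp
  · simp [hk.ne', hk.ne]

theorem firstMoment_eq_zero_iff (p : ProbabilityMeasure ℕ) :
    firstMoment p = 0 ↔ p = diracZero := by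
  constructor
  · intro h
    have h1 : ∀ k ≠ 0, (p : Measure ℕ) {k} = 0 := by
      intro k hk
      simpa [hk] using (ENNReal.tsum_eq_zero.1 h) k
    have h2 : (p : Measure ℕ) {0} = 1 := by
      have : (p : Measure ℕ) Set.univ = 1 := measure_univ
      rw [← lintegral_one, lintegral_countable', tsum_eq_single 0] at this
      · simpa using this
      · intro k hk; simp [h1 k hk]
    refine Subtype.ext (Measure.ext_of_singleton fun k => ?_)
    rcases Nat.eq_zero_or_pos k with rfl | hk
    · simpa [diracZero] using h2
    · simpa [diracZero, hk.ne] using h1 k hk.ne'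
  · rintro rfl
    refine ENNReal.tsum_eq_zero.2 fun k => ?_
    rcases Nat.eq_zero_or_pos k with rfl | hk
    · simp
    · simp [diracZero, hk.ne]

theorem rate_zero_diracZero : rate 0 diracZero = 0 := by
  rw [rate_of_eq (by simpa using (firstMoment_eq_zero_iff diracZero).2 rfl), poissonMeasure_zero]
  exact klDiv_self _

theorem rate_zero_of_ne {p : ProbabilityMeasure ℕ} (h : p ≠ diracZero) : rate 0 p = ∞ :=
  rate_of_ne (by simpa [firstMoment_eq_zero_iff] using h)

theorem lowerSemicontinuous_rate (c : ℝ≥0) : LowerSemicontinuous (rate c) := by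
  rcases eq_zero_or_pos c with rfl | hc
  · refine lowerSemicontinuous_of_isClosed_coe fun a => ?_
    have : {p | rate 0 p ≤ a} = {diracZero} := by
      ext p
      by_cases h : p = diracZero
      · simp [h, rate_zero_diracZero]
      · simp [h, rate_zero_of_ne h]
    rw [this]
    exact isClosed_singleton
  · exact lowerSemicontinuous_rate_of_pos hc

end Entropy

/-! ### Sequences of ordered pairs and their endpoint counts -/

section Sequences

variable {V : Type*}

theorem ncard_fin_cons {X : Type*} [Fintype X] {m : ℕ} (P : (Fin (m + 1) → X) → Prop) :
    {s | P s}.ncard = ∑ x, {s : Fin m → X | P (Fin.cons x s)}.ncard := by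
  classical
  rw [← Nat.card_coe_set_eq]
  have e : {s | P s} ≃ Σ x : X, {s : Fin m → X | P (Fin.cons x s)} :=
    { toFun := fun s => ⟨s.1 0, Fin.tail s.1, by
        change P _
        rw [Fin.cons_self_tail]
        exact s.2⟩
      invFun := fun y => ⟨Fin.cons y.1 y.2.1, y.2.2⟩
      left_inv := fun s => by simp
      right_inv := fun _ => rfl }
  rw [Nat.card_congr e, Nat.card_sigma]
  rfl

theorem ncard_pairs_mk_eq {e : Sym2 V} (he : ¬ e.IsDiag) :
    {x : V × V | s(x.1, x.2) = e}.ncard = 2 := by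
  induction e with
  | h a b =>
    have hab : a ≠ b := by simpa using he
    have : {x : V × V | s(x.1, x.2) = s(a, b)} = {(a, b), (b, a)} := by
      ext ⟨x, y⟩
      simp
    rw [this, Set.ncard_pair]
    simp [hab]

variable [DecidableEq V]

/-- The number of times a vertex occurs as an endpoint in a sequence of pairs. -/
def endpointCount {m : ℕ} (s : Fin m → V × V) : V → ℕ :=
  ∑ k, (Pi.single (s k).1 1 + Pi.single (s k).2 1)

theorem endpointCount_cons {m : ℕ} (x : V × V) (s : Fin m → V × V) :
    endpointCount (Fin.cons x s : Fin (m + 1) → V × V) =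
      Pi.single x.1 1 + (Pi.single x.2 1 + endpointCount s) := by
  simp [endpointCount, Fin.sum_univ_succ, add_assoc]

theorem endpointCount_append {t J : ℕ} (a : Fin t → V × V) (b : Fin J → V × V) :
    endpointCount (Fin.append a b) = endpointCount a + endpointCount b := by
  simp [endpointCount, Fin.sum_univ_add]

theorem endpointCount_fin_zero (s : Fin 0 → V × V) : endpointCount s = 0 := by
  simp [endpointCount]

/-- The sequence lists distinct non-loop edges outside `E`. -/
def IsSimpleSeq {m : ℕ} (E : Finset (Sym2 V)) (s : Fin m → V × V) : Prop :=
  (∀ k, (s k).1 ≠ (s k).2 ∧ s((s k).1, (s k).2) ∉ E) ∧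
    Function.Injective fun k => s((s k).1, (s k).2)

/-- The forbidden set `E` is carried along for this recursion: once a pair is drawn, its edge
becomes forbidden for the rest of the sequence. -/
theorem isSimpleSeq_cons {m : ℕ} (E : Finset (Sym2 V)) (x : V × V) (s : Fin m → V × V) :
    IsSimpleSeq E (Fin.cons x s : Fin (m + 1) → V × V) ↔
      (x.1 ≠ x.2 ∧ s(x.1, x.2) ∉ E) ∧ IsSimpleSeq (insert s(x.1, x.2) E) s := by
  have h : (fun k => s(((Fin.cons x s : Fin (m + 1) → V × V) k).1,
      ((Fin.cons x s : Fin (m + 1) → V × V) k).2)) =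
      Fin.cons s(x.1, x.2) (fun k => s((s k).1, (s k).2)) := by
    funext k
    refine Fin.cases ?_ (fun k => ?_) k <;> simp
  unfold IsSimpleSeq
  rw [h, Fin.cons_injective_iff, Fin.forall_fin_succ]
  simp only [Fin.cons_zero, Fin.cons_succ, Finset.mem_insert, Set.mem_range, not_exists, not_or]
  constructor
  · rintro ⟨⟨h1, h2⟩, h3, h4⟩
    exact ⟨h1, fun k => ⟨(h2 k).1, h3 k, (h2 k).2⟩, h4⟩
  · rintro ⟨h1, h2, h3⟩
    exact ⟨⟨h1, fun k => ⟨(h2 k).1, (h2 k).2.2⟩⟩, fun k => (h2 k).2.1, h3⟩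

theorem isSimpleSeq_append {t J : ℕ} {E : Finset (Sym2 V)} {a : Fin t → V × V}
    {b : Fin J → V × V} (ha : IsSimpleSeq E a)
    (hb : IsSimpleSeq (E ∪ Finset.univ.image fun k => s((a k).1, (a k).2)) b) :
    IsSimpleSeq E (Fin.append a b) := by
  have h : (fun k => s(((Fin.append a b) k).1, ((Fin.append a b) k).2)) =
      Fin.append (fun k => s((a k).1, (a k).2)) (fun k => s((b k).1, (b k).2)) := by
    funext k
    refine Fin.addCases (fun k => ?_) (fun k => ?_) k <;> simp
  refine ⟨fun k => ?_, ?_⟩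
  · refine Fin.addCases (fun k => ?_) (fun k => ?_) k
    · simpa using ha.1 k
    · have := hb.1 k
      simp only [Finset.mem_union, not_or] at this
      simpa using ⟨this.1, this.2.1⟩
  · rw [h, Fin.append_injective_iff]
    refine ⟨ha.2, hb.2, fun i j hij => ?_⟩
    refine (hb.1 j).2 ?_
    simp only [Finset.mem_union, Finset.mem_image, Finset.mem_univ, true_and]
    exact Or.inr ⟨i, hij⟩

variable [Fintype V]

theorem sum_endpointCount {m : ℕ} (s : Fin m → V × V) : ∑ i, endpointCount s i = 2 * m := by
  simp [endpointCount, Finset.sum_add_distrib, Finset.sum_comm (s := (Finset.univ : Finset V))]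
  omega

theorem card_pairs_mk_mem {E : Finset (Sym2 V)} (hE : ∀ e ∈ E, ¬ e.IsDiag) :
    (Finset.univ.filter fun x : V × V => s(x.1, x.2) ∈ E).card = 2 * E.card := by
  rw [Finset.card_eq_sum_card_fiberwise (f := fun x : V × V => s(x.1, x.2)) (t := E)]
  · rw [Finset.sum_const_nat (m := 2), mul_comm]
    intro e he
    rw [← ncard_pairs_mk_eq (hE e he), ← Set.ncard_coe_finset]
    congr 1
    ext x
    simp only [Finset.coe_filter, Finset.mem_filter, Finset.mem_univ, true_and, Set.mem_ofPred_eq]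
    constructor
    · exact fun h => h.2
    · exact fun h => ⟨h ▸ he, h⟩
  · intro x hx
    simpa using hx

/-- The edges can be listed in `m!` orders and each edge oriented in two ways. In the induction the
first entry is one of `2 * (m + 1)` ordered pairs, and its edge is then erased from `E`. -/
theorem ncard_seqs_of_edges {m : ℕ} {E : Finset (Sym2 V)} (hE : ∀ e ∈ E, ¬ e.IsDiag)
    (hm : E.card = m) :
    {s : Fin m → V × V | (∀ k, s((s k).1, (s k).2) ∈ E) ∧
      Function.Injective fun k => s((s k).1, (s k).2)}.ncard = m.factorial * 2 ^ m := by
  induction m generalizing E with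
  | zero =>
    have : {s : Fin 0 → V × V | (∀ k, s((s k).1, (s k).2) ∈ E) ∧
      Function.Injective fun k => s((s k).1, (s k).2)} = Set.univ := by
      ext s
      simp [Function.injective_of_subsingleton]
    rw [this, Set.ncard_univ]
    simp
  | succ m ih =>
    rw [ncard_fin_cons]
    have key : ∀ x : V × V, {s : Fin m → V × V |
        (∀ k, s(((Fin.cons x s : Fin (m + 1) → V × V) k).1,
          ((Fin.cons x s : Fin (m + 1) → V × V) k).2) ∈ E) ∧
        Function.Injective fun k => s(((Fin.cons x s : Fin (m + 1) → V × V) k).1,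
          ((Fin.cons x s : Fin (m + 1) → V × V) k).2)}.ncard =
        if s(x.1, x.2) ∈ E then m.factorial * 2 ^ m else 0 := by
      intro x
      have h : ∀ s : Fin m → V × V, (fun k => s(((Fin.cons x s : Fin (m + 1) → V × V) k).1,
          ((Fin.cons x s : Fin (m + 1) → V × V) k).2)) =
          Fin.cons s(x.1, x.2) (fun k => s((s k).1, (s k).2)) := by
        intro s
        funext k
        refine Fin.cases ?_ (fun k => ?_) k <;> simp
      split_ifs with hx
      · rw [← ih (E := E.erase s(x.1, x.2)) (fun e he => hE e (Finset.mem_of_mem_erase he))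
          (by rw [Finset.card_erase_of_mem hx]; omega)]
        congr 1
        ext s
        simp only [Set.mem_ofPred_eq, h, Fin.cons_injective_iff, Fin.forall_fin_succ, Fin.cons_zero,
          Fin.cons_succ, hx, true_and, Finset.mem_erase, Set.mem_range, not_exists]
        constructor
        · rintro ⟨h1, h2, h3⟩
          exact ⟨fun k => ⟨h2 k, h1 k⟩, h3⟩
        · rintro ⟨h1, h2⟩
          exact ⟨fun k => (h1 k).2, fun k => (h1 k).1, h2⟩
      · convert Set.ncard_empty (Fin m → V × V)
        ext s
        simp [Fin.forall_fin_succ, hx]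
    simp_rw [key]
    rw [← Finset.sum_filter, Finset.sum_const, card_pairs_mk_mem hE, hm, Nat.factorial_succ,
      pow_succ, smul_eq_mul]
    ring

end Sequences

/-! ### From graphs to simple sequences -/

section Graphs

variable {V : Type*}

/-- The simple graph whose edges are the pairs of a sequence. -/
def seqGraph {m : ℕ} (s : Fin m → V × V) : SimpleGraph V :=
  SimpleGraph.fromEdgeSet (Set.range fun k => s((s k).1, (s k).2))

theorem edgeSet_seqGraph {m : ℕ} {s : Fin m → V × V} (hs : ∀ k, (s k).1 ≠ (s k).2) :
    (seqGraph s).edgeSet = Set.range fun k => s((s k).1, (s k).2) := by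
  rw [seqGraph, SimpleGraph.edgeSet_fromEdgeSet, sdiff_eq_left, Set.disjoint_left]
  rintro _ ⟨k, rfl⟩
  simpa using hs k

/-- Without loops, a position contributes at most one to the count at `i`. Without repetitions,
positions touching `i` correspond to edges incident to `i`. -/
theorem endpointCount_eq_ncard_neighborSet [DecidableEq V] {m : ℕ} {E : Finset (Sym2 V)}
    {s : Fin m → V × V} (hs : IsSimpleSeq E s) (i : V) :
    endpointCount s i = ((seqGraph s).neighborSet i).ncard := by
  have h1 : endpointCount s i =
      (Finset.univ.filter fun k => i = (s k).1 ∨ i = (s k).2).card := by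
    rw [endpointCount, Finset.sum_apply, Finset.card_filter]
    refine Finset.sum_congr rfl fun k _ => ?_
    have := (hs.1 k).1
    by_cases h : i = (s k).1
    · have h' : i ≠ (s k).2 := h ▸ this
      simp [← h, h']
    · simp [Pi.single_apply, h]
  have h2 : ((seqGraph s).incidenceSet i) = (fun k => s((s k).1, (s k).2)) ''
      (Finset.univ.filter fun k => i = (s k).1 ∨ i = (s k).2 : Finset (Fin m)) := by
    ext e
    rw [SimpleGraph.incidenceSet, edgeSet_seqGraph fun k => (hs.1 k).1]
    simp only [Set.mem_ofPred_eq, Set.mem_range, Finset.coe_filter, Finset.mem_univ, true_and,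
      Set.mem_image]
    constructor
    · rintro ⟨⟨k, rfl⟩, hi⟩
      exact ⟨k, by simpa using hi, rfl⟩
    · rintro ⟨k, hk, rfl⟩
      exact ⟨⟨k, rfl⟩, by simpa using hk⟩
  rw [h1, ← Set.ncard_coe_finset, ← Set.ncard_image_of_injective _ hs.2, ← h2,
    ← Nat.card_coe_set_eq, ← Nat.card_coe_set_eq]
  exact Nat.card_congr ((seqGraph s).incidenceSetEquivNeighborSet i)

variable [Fintype V] [DecidableEq V]

/-- Every fibre of `seqGraph` over a graph with `m` edges has `m! * 2 ^ m` elements. This factor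
does not depend on `P`, so it cancels in probabilities. -/
theorem ncard_graphs_mul (m : ℕ) (P : (V → ℕ) → Prop) :
    {G : SimpleGraph V | G.edgeSet.ncard = m ∧ P fun i => (G.neighborSet i).ncard}.ncard *
      (m.factorial * 2 ^ m) =
    {s : Fin m → V × V | IsSimpleSeq ∅ s ∧ P (endpointCount s)}.ncard := by
  classical
  rw [Set.ncard_eq_toFinset_card' {s : Fin m → V × V | _},
    Finset.card_eq_sum_card_fiberwise (f := seqGraph) (t := {G : SimpleGraph V |
      G.edgeSet.ncard = m ∧ P fun i => (G.neighborSet i).ncard}.toFinset),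
    Finset.sum_const_nat (m := m.factorial * 2 ^ m), Set.ncard_eq_toFinset_card']
  · intro G hG
    simp only [Set.mem_toFinset, Set.mem_ofPred_eq] at hG
    have hE : ∀ e ∈ G.edgeFinset, ¬ e.IsDiag := fun e he =>
      G.not_isDiag_of_mem_edgeSet (by simpa using he)
    have hcard : G.edgeFinset.card = m := by
      rw [← hG.1, ← SimpleGraph.coe_edgeFinset, Set.ncard_coe_finset]
    rw [← ncard_seqs_of_edges hE hcard, ← Set.ncard_coe_finset]
    congr 1
    ext s
    simp only [Finset.coe_filter, Set.mem_toFinset, Set.mem_ofPred_eq]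
    constructor
    · rintro ⟨⟨hs, -⟩, rfl⟩
      refine ⟨fun k => ?_, hs.2⟩
      rw [SimpleGraph.mem_edgeFinset, edgeSet_seqGraph fun k => (hs.1 k).1]
      exact ⟨k, rfl⟩
    · rintro ⟨h1, h2⟩
      have hs : IsSimpleSeq ∅ s := ⟨fun k => ⟨by simpa using hE _ (h1 k), by simp⟩, h2⟩
      have himg : Finset.univ.image (fun k => s((s k).1, (s k).2)) = G.edgeFinset := by
        refine Finset.eq_of_subset_of_card_le ?_ ?_
        · intro e he
          obtain ⟨k, -, rfl⟩ := Finset.mem_image.1 he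
          exact h1 k
        · rw [Finset.card_image_of_injective _ h2, hcard]
          simp
      have hG' : seqGraph s = G := by
        rw [seqGraph, ← SimpleGraph.fromEdgeSet_edgeSet G, ← SimpleGraph.coe_edgeFinset, ← himg]
        simp
      refine ⟨⟨hs, ?_⟩, hG'⟩
      have : endpointCount s = fun i => (G.neighborSet i).ncard := by
        funext i
        rw [endpointCount_eq_ncard_neighborSet hs, hG']
      rw [this]
      exact hG.2
  · intro s hs
    simp only [Set.coe_toFinset, Set.mem_ofPred_eq] at hs ⊢
    refine ⟨?_, ?_⟩
    · rw [edgeSet_seqGraph fun k => (hs.1.1 k).1, ← Set.image_univ,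
        Set.ncard_image_of_injective _ hs.1.2]
      simp
    · have : (fun i => ((seqGraph s).neighborSet i).ncard) = endpointCount s := by
        funext i
        rw [endpointCount_eq_ncard_neighborSet hs.1]
      rw [this]
      exact hs.2

end Graphs

/-! ### Counting simple sequences and patching the last pairs -/

section Counting

variable {V : Type*} [Fintype V] [DecidableEq V]

theorem card_pairs_mk_mem_le (E : Finset (Sym2 V)) :
    (Finset.univ.filter fun x : V × V => x.1 ≠ x.2 ∧ s(x.1, x.2) ∈ E).card ≤ 2 * E.card := by
  have h := card_pairs_mk_mem (E := E.filter fun e => ¬ e.IsDiag)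
    (fun e he => (Finset.mem_filter.1 he).2)
  have : (Finset.univ.filter fun x : V × V => x.1 ≠ x.2 ∧ s(x.1, x.2) ∈ E) =
      Finset.univ.filter fun x : V × V => s(x.1, x.2) ∈ E.filter fun e => ¬ e.IsDiag := by
    ext x
    simp [and_comm]
  rw [this, h]
  gcongr
  exact Finset.filter_subset _ _

theorem le_card_pairs_notMem (E : Finset (Sym2 V)) :
    Fintype.card V * (Fintype.card V - 1) - 2 * E.card ≤
      (Finset.univ.filter fun x : V × V => x.1 ≠ x.2 ∧ s(x.1, x.2) ∉ E).card := by
  have h := card_pairs_mk_mem_le E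
  have h1 := Finset.card_filter_add_card_filter_not (s := (Finset.univ : Finset V).offDiag)
    (fun x : V × V => s(x.1, x.2) ∈ E)
  have e1 : (Finset.univ : Finset V).offDiag.filter (fun x : V × V => s(x.1, x.2) ∈ E) =
      Finset.univ.filter fun x : V × V => x.1 ≠ x.2 ∧ s(x.1, x.2) ∈ E := by
    ext x; simp
  have e2 : (Finset.univ : Finset V).offDiag.filter (fun x : V × V => ¬ s(x.1, x.2) ∈ E) =
      Finset.univ.filter fun x : V × V => x.1 ≠ x.2 ∧ s(x.1, x.2) ∉ E := by
    ext x; simp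
  rw [e1, e2, Finset.offDiag_card, Finset.card_univ] at h1
  have : Fintype.card V * (Fintype.card V - 1) =
      Fintype.card V * Fintype.card V - Fintype.card V := by
    rw [Nat.mul_sub, mul_one]
  omega

/-- At every step at most `|E| + m` edges are forbidden, that is, twice as many ordered pairs. The
base of the power is this worst case, which does not change along the induction. -/
theorem pow_le_ncard_isSimpleSeq (m : ℕ) (E : Finset (Sym2 V)) :
    (Fintype.card V * (Fintype.card V - 1) - 2 * (E.card + m)) ^ m ≤
      {s : Fin m → V × V | IsSimpleSeq E s}.ncard := by
  induction m generalizing E with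
  | zero =>
    have : {s : Fin 0 → V × V | IsSimpleSeq E s} = Set.univ := by
      ext s
      simp [IsSimpleSeq, Function.injective_of_subsingleton]
    rw [this, Set.ncard_univ]
    simp
  | succ m ih =>
    rw [ncard_fin_cons]
    set N := Fintype.card V * (Fintype.card V - 1) - 2 * (E.card + (m + 1)) with hN
    have key : ∀ x : V × V, (if x.1 ≠ x.2 ∧ s(x.1, x.2) ∉ E then N ^ m else 0) ≤
        {s : Fin m → V × V | IsSimpleSeq E (Fin.cons x s : Fin (m + 1) → V × V)}.ncard := by
      intro x
      split_ifs with hx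
      · refine le_trans ?_ ((ih (insert s(x.1, x.2) E)).trans (le_of_eq ?_))
        · gcongr
          have := Finset.card_insert_le s(x.1, x.2) E
          omega
        · congr 1
          ext s
          simp [isSimpleSeq_cons, hx]
      · simp
    refine le_trans ?_ (Finset.sum_le_sum fun x _ => key x)
    rw [← Finset.sum_filter, Finset.sum_const, smul_eq_mul, pow_succ, mul_comm]
    gcongr
    refine le_trans ?_ (le_card_pairs_notMem E)
    omega

theorem exists_isSimpleSeq {J : ℕ} {E : Finset (Sym2 V)}
    (h : 2 * (E.card + J) < Fintype.card V * (Fintype.card V - 1)) :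
    ∃ s : Fin J → V × V, IsSimpleSeq E s := by
  have h1 := pow_le_ncard_isSimpleSeq J E
  have h2 : 0 < (Fintype.card V * (Fintype.card V - 1) - 2 * (E.card + J)) ^ J :=
    pow_pos (by omega) _
  exact Set.nonempty_of_ncard_ne_zero (h2.trans_le h1).ne'

/-- A tail `b`, possibly not simple, is replaced by a simple extension `ext a` chosen from `a`
alone. The map `(a, b) ↦ (a ++ ext a, b)` is injective, and keeping `b` costs the factor `(n ^ 2) ^
J`. The relation between degrees is an equality of sums, which avoids subtraction in `ℕ`. -/
theorem ncard_le_mul_ncard_patched {t J : ℕ} (D : Set (V → ℕ))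
    (h : 2 * (t + J) < Fintype.card V * (Fintype.card V - 1)) :
    {ab : (Fin t → V × V) × (Fin J → V × V) | IsSimpleSeq ∅ ab.1 ∧
        endpointCount ab.1 + endpointCount ab.2 ∈ D}.ncard ≤
      {s : Fin (t + J) → V × V | IsSimpleSeq ∅ s ∧ ∃ d ∈ D, ∃ b b' : Fin J → V × V,
        endpointCount s + endpointCount b = d + endpointCount b'}.ncard *
        (Fintype.card V ^ 2) ^ J := by
  classical
  have hex : ∀ a : Fin t → V × V, ∃ b : Fin J → V × V,
      IsSimpleSeq (∅ ∪ Finset.univ.image fun k => s((a k).1, (a k).2)) b := by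
    intro a
    refine exists_isSimpleSeq (lt_of_le_of_lt ?_ h)
    gcongr
    rw [Finset.empty_union]
    exact Finset.card_image_le.trans (by simp)
  choose ext hext using hex
  have hcard : (Set.univ : Set (Fin J → V × V)).ncard = (Fintype.card V ^ 2) ^ J := by
    rw [Set.ncard_univ]
    simp [sq]
  rw [← hcard, ← Set.ncard_prod]
  refine Set.ncard_le_ncard_of_injOn (fun ab => (Fin.append ab.1 (ext ab.1), ab.2)) ?_ ?_
  · rintro ⟨a, b⟩ ⟨ha, hd⟩
    refine ⟨⟨isSimpleSeq_append ha (hext a), _, hd, b, ext a, ?_⟩, trivial⟩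
    simp only [endpointCount_append]
    exact add_right_comm _ _ _
  · rintro ⟨a, b⟩ - ⟨a', b'⟩ - hab
    simp only [Prod.mk.injEq] at hab
    have : a = a' := by
      funext k
      have := congrFun hab.1 (Fin.castAdd J k)
      simpa using this
    rw [this, hab.2]

end Counting

/-! ### Multinomial counts, and the proportion of arrangements that start simply -/

section Arrangements

variable {V : Type*}

section

variable [DecidableEq V]

/-- The number of ways to pick an ordered pair of half-edges at `x.1` and `x.2`. -/
def pairWeight (d : V → ℕ) (x : V × V) : ℝ :=
  d x.1 * ((d x.2 : ℝ) - if x.1 = x.2 then 1 else 0)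

theorem pairWeight_nonneg (d : V → ℕ) (x : V × V) : 0 ≤ pairWeight d x := by
  unfold pairWeight
  split_ifs with h
  · rw [h]
    rcases Nat.eq_zero_or_pos (d x.2) with h0 | h0
    · simp [h0]
    · have : (1 : ℝ) ≤ d x.2 := by exact_mod_cast h0
      exact mul_nonneg (by positivity) (by linarith)
  · rw [sub_zero]
    positivity

theorem pairWeight_le (d : V → ℕ) (x : V × V) : pairWeight d x ≤ d x.1 * d x.2 := by
  unfold pairWeight
  gcongr
  split_ifs <;> simp

/-- A nonzero weight ensures that two half-edges can be removed; for `i = j` this needs `d i ≥ 2`,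
which the correction `- 1` in the weight enforces. -/
theorem exists_eq_single_add_single_add {d : V → ℕ} {i j : V} (h : pairWeight d (i, j) ≠ 0) :
    ∃ d' : V → ℕ, d = Pi.single i 1 + (Pi.single j 1 + d') := by
  unfold pairWeight at h
  have hi : d i ≠ 0 := by
    rintro h0
    simp [h0] at h
  refine ⟨d - Pi.single i 1 - Pi.single j 1, ?_⟩
  funext k
  by_cases hij : i = j
  · subst hij
    have : d i ≠ 1 := by
      rintro h0
      simp [h0] at h
    by_cases hk : k = i
    · subst hk
      simp
      omega
    · simp [hk]
  · have hj : d j ≠ 0 := by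
      rintro h0
      simp [hij, h0] at h
    by_cases hk : k = i
    · subst hk
      simp [hij]
      omega
    · by_cases hk' : k = j
      · subst hk'
        simp [hk]
        omega
      · simp [hk, hk']

end

variable [Fintype V]

/-- The number of words of length `∑ i, d i` in which every letter `i` occurs `d i` times. -/
def arrangements (d : V → ℕ) : ℝ := (∑ i, d i).factorial / ∏ i, ((d i).factorial : ℝ)

theorem arrangements_pos (d : V → ℕ) : 0 < arrangements d := by
  unfold arrangements
  have : ∀ i, 0 < ((d i).factorial : ℝ) := fun i => by exact_mod_cast Nat.factorial_pos _
  exact div_pos (by exact_mod_cast Nat.factorial_pos _) (Finset.prod_pos fun i _ => this i)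

variable [DecidableEq V]

theorem sum_single_add (i : V) (d : V → ℕ) :
    ∑ j, (Pi.single i 1 + d : V → ℕ) j = ∑ j, d j + 1 := by
  simp [Finset.sum_add_distrib, add_comm]

theorem arrangements_single_add (i : V) (d : V → ℕ) :
    arrangements (Pi.single i 1 + d) * ((d i : ℝ) + 1) = arrangements d * ((∑ j, d j : ℕ) + 1) := by
  have hd : ∏ j, ((((Pi.single i 1 + d : V → ℕ) j).factorial : ℕ) : ℝ) =
      ((d i : ℝ) + 1) * ∏ j, ((d j).factorial : ℝ) := by
    rw [← Finset.mul_prod_erase _ _ (Finset.mem_univ i),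
      ← Finset.mul_prod_erase _ (fun j => ((d j).factorial : ℝ)) (Finset.mem_univ i)]
    have h1 : ∏ j ∈ Finset.univ.erase i, ((((Pi.single i 1 + d : V → ℕ) j).factorial : ℕ) : ℝ) =
        ∏ j ∈ Finset.univ.erase i, ((d j).factorial : ℝ) := by
      refine Finset.prod_congr rfl fun j hj => ?_
      simp [Finset.ne_of_mem_erase hj]
    rw [h1]
    simp only [Pi.add_apply, Pi.single_eq_same]
    rw [add_comm 1, Nat.factorial_succ]
    push_cast
    ring
  have hpos : 0 < ∏ j, ((d j).factorial : ℝ) :=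
    Finset.prod_pos fun i _ => by exact_mod_cast Nat.factorial_pos _
  unfold arrangements
  rw [hd, sum_single_add, Nat.factorial_succ]
  push_cast
  field_simp

theorem sum_pairWeight (d : V → ℕ) :
    ∑ x, pairWeight d x = (∑ i, d i : ℕ) * ((∑ i, d i : ℕ) - 1 : ℝ) := by
  rw [Fintype.sum_prod_type]
  simp only [pairWeight, mul_sub, mul_ite, mul_one, mul_zero, Finset.sum_sub_distrib,
    Finset.sum_ite_eq, Finset.mem_univ, if_true, ← Finset.mul_sum, ← Finset.sum_mul]
  push_cast
  ring

/-- Removing two half-edges. -/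
theorem arrangements_pair (i j : V) (d : V → ℕ) :
    arrangements (Pi.single i 1 + (Pi.single j 1 + d)) *
        pairWeight (Pi.single i 1 + (Pi.single j 1 + d)) (i, j) =
      arrangements d * ((∑ k, d k : ℕ) + 1) * ((∑ k, d k : ℕ) + 2) := by
  have h1 := arrangements_single_add i (Pi.single j 1 + d)
  have h2 := arrangements_single_add j d
  rw [sum_single_add] at h1
  have hw : pairWeight (Pi.single i 1 + (Pi.single j 1 + d)) (i, j) =
      (((Pi.single j 1 + d : V → ℕ) i : ℝ) + 1) * ((d j : ℝ) + 1) := by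
    unfold pairWeight
    by_cases h : i = j
    · subst h
      simp
      ring
    · have h' : j ≠ i := fun e => h e.symm
      simp [h, h']
      ring
  rw [hw, ← mul_assoc, h1, mul_right_comm, h2]
  push_cast
  ring

/-- Fixing the first pair `x` multiplies the multinomial by `pairWeight d x / (M * (M - 1))`, where
`M` is the total degree. By `sum_pairWeight` these factors add up to one. -/
theorem ncard_endpointCount_eq (J : ℕ) (d : V → ℕ) (hd : ∑ i, d i = 2 * J) :
    ({s : Fin J → V × V | endpointCount s = d}.ncard : ℝ) = arrangements d := by
  induction J generalizing d with
  | zero =>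
    have h0 : d = 0 := by
      funext i
      have := Finset.sum_eq_zero_iff.1 hd i (Finset.mem_univ i)
      simpa using this
    have : {s : Fin 0 → V × V | endpointCount s = d} = Set.univ := by
      ext s
      simp [endpointCount_fin_zero, h0]
    rw [this, Set.ncard_univ]
    simp [h0, arrangements]
  | succ J ih =>
    rw [ncard_fin_cons]
    have hM : ((∑ i, d i : ℕ) : ℝ) = 2 * J + 2 := by rw [hd]; push_cast; ring
    have key : ∀ x : V × V, ({s : Fin J → V × V |
        endpointCount (Fin.cons x s : Fin (J + 1) → V × V) = d}.ncard : ℝ) =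
        arrangements d / ((2 * J + 2) * (2 * J + 1)) * pairWeight d x := by
      intro x
      by_cases hx : ∃ d' : V → ℕ, d = Pi.single x.1 1 + (Pi.single x.2 1 + d')
      · obtain ⟨d', rfl⟩ := hx
        have hd' : ∑ i, d' i = 2 * J := by
          rw [sum_single_add, sum_single_add] at hd
          omega
        have h := arrangements_pair x.1 x.2 d'
        rw [hd'] at h
        rw [div_mul_eq_mul_div, h, ← ih d' hd']
        have : {s : Fin J → V × V | endpointCount (Fin.cons x s : Fin (J + 1) → V × V) =
            Pi.single x.1 1 + (Pi.single x.2 1 + d')} = {s | endpointCount s = d'} := by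
          ext s
          simp [endpointCount_cons]
        rw [this]
        push_cast
        field_simp
      · have h0 : pairWeight d x = 0 := by
          by_contra h
          exact hx (exists_eq_single_add_single_add h)
        rw [h0, mul_zero]
        norm_cast
        convert Set.ncard_empty (Fin J → V × V)
        ext s
        simp only [endpointCount_cons, Set.mem_ofPred_eq, Set.mem_empty_iff_false, iff_false]
        exact fun h => hx ⟨_, h.symm⟩
    push_cast
    simp_rw [key]
    rw [← Finset.mul_sum, sum_pairWeight, hM]
    have : (0 : ℝ) < 2 * J + 1 := by positivity
    field_simp
    ring

/-- The pairs that can be appended to a sequence avoiding `E` carry most of the weight. -/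
theorem le_sum_pairWeight (K : ℕ) (E : Finset (Sym2 V)) (d : V → ℕ)
    (hK : ∀ i, d i + (Finset.univ.filter fun j => s(i, j) ∈ E).card ≤ K) :
    (∑ i, d i : ℕ) * ((∑ i, d i : ℕ) - 1 : ℝ) - (K + K ^ 2) * (∑ i, d i : ℕ) ≤
      ∑ x with x.1 ≠ x.2 ∧ s(x.1, x.2) ∉ E, pairWeight d x := by
  have hdK : ∀ i, (d i : ℝ) ≤ K := fun i => by exact_mod_cast (Nat.le_add_right _ _).trans (hK i)
  have h1 : ∑ x, pairWeight d x ≤ ∑ x with x.1 ≠ x.2 ∧ s(x.1, x.2) ∉ E, pairWeight d x +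
      (∑ x with x.1 = x.2, pairWeight d x + ∑ x with s(x.1, x.2) ∈ E, pairWeight d x) := by
    simp only [Finset.sum_filter, ← Finset.sum_add_distrib]
    refine Finset.sum_le_sum fun x _ => ?_
    have := pairWeight_nonneg d x
    split_ifs <;> first | linarith | (exfalso; tauto)
  -- Loops: a loop at `i` has weight at most `d i * d i ≤ K * d i`.
  have h2 : ∑ x with x.1 = x.2, pairWeight d x ≤ K * (∑ i, d i : ℕ) := by
    calc ∑ x with x.1 = x.2, pairWeight d x
        ≤ ∑ x : V × V with x.1 = x.2, (K : ℝ) * d x.1 := by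
          refine Finset.sum_le_sum fun x _ => (pairWeight_le d x).trans ?_
          rw [mul_comm]
          gcongr
          exact_mod_cast hdK _
      _ = K * (∑ i, d i : ℕ) := by
          rw [Finset.sum_filter, Fintype.sum_prod_type]
          simp [Finset.mul_sum]
  -- Forbidden edges: a vertex `i` has at most `K` partners in `E`, each pair weighing at most `K *
  -- d i`.
  have h3 : ∑ x with s(x.1, x.2) ∈ E, pairWeight d x ≤ K ^ 2 * (∑ i, d i : ℕ) := by
    calc ∑ x with s(x.1, x.2) ∈ E, pairWeight d x
        ≤ ∑ x : V × V with s(x.1, x.2) ∈ E, (K : ℝ) * d x.1 := by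
          refine Finset.sum_le_sum fun x _ => (pairWeight_le d x).trans ?_
          rw [mul_comm]
          gcongr
          exact_mod_cast hdK _
      _ = ∑ i, (K : ℝ) * d i * (Finset.univ.filter fun j => s(i, j) ∈ E).card := by
          rw [Finset.sum_filter, Fintype.sum_prod_type]
          refine Finset.sum_congr rfl fun i _ => ?_
          rw [← Finset.sum_filter]
          change ∑ a with s(i, a) ∈ E, (K : ℝ) * d i = _
          rw [Finset.sum_const, nsmul_eq_mul, mul_comm]
      _ ≤ ∑ i, (K : ℝ) * d i * K := by
          gcongr with i
          exact_mod_cast (Nat.le_add_left _ _).trans (hK i)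
      _ = K ^ 2 * (∑ i, d i : ℕ) := by
          rw [← Finset.sum_mul, ← Finset.mul_sum]
          push_cast
          ring
  rw [sum_pairWeight] at h1
  linarith

/-- Most arrangements of a bounded degree sequence have no loop and no repeated edge among their
first `t` pairs, up to a factor that is subexponential for `t` of order `J ^ 2`. -/
theorem le_ncard_isSimpleSeq_endpointCount (K t J : ℕ) (E : Finset (Sym2 V)) (d : V → ℕ)
    (hd : ∑ i, d i = 2 * (t + J)) (hJ : K + K ^ 2 ≤ 2 * J)
    (hK : ∀ i, d i + (Finset.univ.filter fun j => s(i, j) ∈ E).card ≤ K) :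
    (1 - (K + K ^ 2 : ℝ) / (2 * J)) ^ t * arrangements d ≤
      {ab : (Fin t → V × V) × (Fin J → V × V) | IsSimpleSeq E ab.1 ∧
        endpointCount ab.1 + endpointCount ab.2 = d}.ncard := by
  have hρ : 0 ≤ 1 - (K + K ^ 2 : ℝ) / (2 * J) := by
    rw [sub_nonneg]
    refine div_le_one_of_le₀ ?_ (by positivity)
    exact_mod_cast hJ
  set ρ := 1 - (K + K ^ 2 : ℝ) / (2 * J) with hρdef
  induction t generalizing E d with
  | zero =>
    rw [pow_zero, one_mul, ← ncard_endpointCount_eq J d (by omega)]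
    norm_cast
    refine Set.ncard_le_ncard_of_injOn (fun b => (Fin.elim0, b)) ?_ ?_
    · intro b hb
      refine ⟨⟨fun k => k.elim0, Function.injective_of_subsingleton _⟩, ?_⟩
      simpa [endpointCount_fin_zero] using hb
    · intro b _ b' _ h
      simpa using h
  | succ t ih =>
    have hsplit : {ab : (Fin (t + 1) → V × V) × (Fin J → V × V) | IsSimpleSeq E ab.1 ∧
        endpointCount ab.1 + endpointCount ab.2 = d}.ncard =
        ∑ x, {ab : (Fin t → V × V) × (Fin J → V × V) |
          IsSimpleSeq E (Fin.cons x ab.1 : Fin (t + 1) → V × V) ∧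
          endpointCount (Fin.cons x ab.1 : Fin (t + 1) → V × V) + endpointCount ab.2 = d}.ncard := by
      rw [← Nat.card_coe_set_eq]
      have e : {ab : (Fin (t + 1) → V × V) × (Fin J → V × V) | IsSimpleSeq E ab.1 ∧
          endpointCount ab.1 + endpointCount ab.2 = d} ≃ Σ x : V × V,
          {ab : (Fin t → V × V) × (Fin J → V × V) |
          IsSimpleSeq E (Fin.cons x ab.1 : Fin (t + 1) → V × V) ∧
          endpointCount (Fin.cons x ab.1 : Fin (t + 1) → V × V) + endpointCount ab.2 = d} :=
        { toFun := fun ab => ⟨ab.1.1 0, (Fin.tail ab.1.1, ab.1.2), by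
            rw [Set.mem_ofPred_eq, Fin.cons_self_tail]
            exact ab.2⟩
          invFun := fun y => ⟨(Fin.cons y.1 y.2.1.1, y.2.1.2), y.2.2⟩
          left_inv := fun ab => by simp
          right_inv := fun _ => rfl }
      rw [Nat.card_congr e, Nat.card_sigma]
      rfl
    rw [hsplit]
    have hM : ((∑ i, d i : ℕ) : ℝ) = 2 * (t + J) + 2 := by rw [hd]; push_cast; ring
    have key : ∀ x : V × V, (if x.1 ≠ x.2 ∧ s(x.1, x.2) ∉ E then
        ρ ^ t * (arrangements d / ((2 * (t + J) + 2) * (2 * (t + J) + 1)) * pairWeight d x)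
          else 0) ≤
        ({ab : (Fin t → V × V) × (Fin J → V × V) |
          IsSimpleSeq E (Fin.cons x ab.1 : Fin (t + 1) → V × V) ∧
          endpointCount (Fin.cons x ab.1 : Fin (t + 1) → V × V) + endpointCount ab.2 = d}.ncard :
          ℝ) := by
      intro x
      split_ifs with hx
      swap
      · positivity
      by_cases hw : pairWeight d x = 0
      · rw [hw, mul_zero, mul_zero]
        positivity
      obtain ⟨d', rfl⟩ := exists_eq_single_add_single_add hw
      have hd' : ∑ i, d' i = 2 * (t + J) := by
        rw [sum_single_add, sum_single_add] at hd
        omega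
      have h := arrangements_pair x.1 x.2 d'
      rw [hd'] at h
      rw [div_mul_eq_mul_div, h]
      push_cast
      have hcancel : arrangements d' * (2 * ((t : ℝ) + J) + 1) * (2 * ((t : ℝ) + J) + 2) /
          ((2 * ((t : ℝ) + J) + 2) * (2 * (t + J) + 1)) = arrangements d' := by
        have : (0 : ℝ) < 2 * (t + J) + 1 := by positivity
        field_simp
      rw [hcancel]
      refine (ih (insert s(x.1, x.2) E) d' hd' ?_).trans (le_of_eq ?_)
      -- The bound `K` on remaining degree plus neighbours in `E` is an invariant: an end of the
      -- drawn pair loses a half-edge and gains at most one neighbour in `E`.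
      · intro i
        have hi := hK i
        simp only [Pi.add_apply] at hi
        by_cases h1 : i = x.1
        · have hsub : (Finset.univ.filter fun j => s(i, j) ∈ insert s(x.1, x.2) E) ⊆
              insert x.2 (Finset.univ.filter fun j => s(i, j) ∈ E) := by
            intro j
            simp only [Finset.mem_filter, Finset.mem_univ, true_and, Finset.mem_insert]
            rintro (h | h)
            · left
              subst h1
              exact Sym2.congr_right.1 h
            · exact Or.inr h
          have := (Finset.card_le_card hsub).trans (Finset.card_insert_le _ _)
          subst h1
          simp only [Pi.single_eq_same] at hi
          omega
        · by_cases h2 : i = x.2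
          · have hsub : (Finset.univ.filter fun j => s(i, j) ∈ insert s(x.1, x.2) E) ⊆
                insert x.1 (Finset.univ.filter fun j => s(i, j) ∈ E) := by
              intro j
              simp only [Finset.mem_filter, Finset.mem_univ, true_and, Finset.mem_insert]
              rintro (h | h)
              · left
                rw [h2, Sym2.eq_swap] at h
                exact Sym2.congr_left.1 h
              · exact Or.inr h
            have := (Finset.card_le_card hsub).trans (Finset.card_insert_le _ _)
            subst h2
            simp only [Pi.single_eq_same] at hi
            omega
          · have hsub : (Finset.univ.filter fun j => s(i, j) ∈ insert s(x.1, x.2) E) ⊆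
                (Finset.univ.filter fun j => s(i, j) ∈ E) := by
              intro j
              simp only [Finset.mem_filter, Finset.mem_univ, true_and, Finset.mem_insert]
              rintro (h | h)
              · rw [Sym2.eq_iff] at h
                tauto
              · exact h
            have := Finset.card_le_card hsub
            omega
      · norm_cast
        congr 1
        ext ab
        simp [isSimpleSeq_cons, endpointCount_cons, hx, add_assoc]
    push_cast
    refine le_trans ?_ (Finset.sum_le_sum fun x _ => key x)
    rw [← Finset.sum_filter, ← Finset.mul_sum, ← Finset.mul_sum]
    have hsum := le_sum_pairWeight K E d hK
    rw [hM] at hsum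
    have hA := arrangements_pos d
    have hden : (0 : ℝ) < (2 * (t + J) + 2) * (2 * (t + J) + 1) := by positivity
    -- With `M = 2 * (t + J) + 2` half-edges left, the relative loss is at most `(K + K ^ 2) / (M -
    -- 1)`, and `M - 1 ≥ 2 * J` as long as `J` pairs are kept in reserve.
    have hρM : ρ * ((2 * (t + J) + 2) * (2 * (t + J) + 1)) ≤
        ∑ x with x.1 ≠ x.2 ∧ s(x.1, x.2) ∉ E, pairWeight d x := by
      refine le_trans ?_ hsum
      have hL : (0 : ℝ) ≤ K + K ^ 2 := by positivity
      have h3 : (K + K ^ 2 : ℝ) ≤ (K + K ^ 2 : ℝ) / (2 * J) * (2 * (t + J) + 1) := by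
        -- If `J = 0`, then `hJ` forces `K = 0` and both sides vanish.
        rcases Nat.eq_zero_or_pos J with rfl | hJ0
        · have : K = 0 := by nlinarith [Nat.zero_le K]
          simp [this]
        · have hJ' : (0 : ℝ) < 2 * J := by positivity
          rw [div_mul_eq_mul_div, le_div_iff₀ hJ']
          gcongr
          have : (0 : ℝ) ≤ t := by positivity
          linarith
      have h4 : (0 : ℝ) ≤ 2 * (t + J) + 2 := by positivity
      rw [hρdef]
      nlinarith [mul_le_mul_of_nonneg_right h3 h4]
    calc ρ ^ (t + 1) * arrangements d
        = ρ ^ t * (arrangements d / ((2 * (t + J) + 2) * (2 * (t + J) + 1)) *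
          (ρ * ((2 * (t + J) + 2) * (2 * (t + J) + 1)))) := by
          rw [pow_succ]
          field_simp
      _ ≤ _ := by gcongr

end Arrangements

/-! ### Counting words with prescribed letter counts -/

section Words

theorem ncard_words_eq {ι : Type*} [Fintype ι] [DecidableEq ι] (n : ℕ) (N : ι → ℕ)
    (hN : ∑ i, N i = n) :
    ({s : Fin n → ι | ∑ k, Pi.single (s k) 1 = N}.ncard : ℝ) = arrangements N := by
  induction n generalizing N with
  | zero =>
    have h0 : N = 0 := by
      funext i
      simpa using Finset.sum_eq_zero_iff.1 hN i (Finset.mem_univ i)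
    have : {s : Fin 0 → ι | ∑ k, Pi.single (s k) 1 = N} = Set.univ := by
      ext s
      simp [h0]
    rw [this, Set.ncard_univ]
    simp [h0, arrangements]
  | succ n ih =>
    rw [ncard_fin_cons]
    have key : ∀ x : ι, ({s : Fin n → ι |
        ∑ k, Pi.single ((Fin.cons x s : Fin (n + 1) → ι) k) 1 = N}.ncard : ℝ) =
        arrangements N / (n + 1) * N x := by
      intro x
      by_cases hx : N x = 0
      · rw [hx, Nat.cast_zero, mul_zero]
        norm_cast
        convert Set.ncard_empty (Fin n → ι)
        ext s
        simp only [Fin.sum_univ_succ, Fin.cons_zero, Set.mem_ofPred_eq, Set.mem_empty_iff_false,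
          iff_false]
        rintro rfl
        simp at hx
      · obtain ⟨N', rfl⟩ : ∃ N' : ι → ℕ, N = Pi.single x 1 + N' := by
          refine ⟨N - Pi.single x 1, ?_⟩
          funext k
          by_cases hk : k = x
          · subst hk
            simp
            omega
          · simp [hk]
        rw [sum_single_add] at hN
        have h := arrangements_single_add x N'
        have hN' : ∑ i, N' i = n := by omega
        rw [hN'] at h
        have e : {s : Fin n → ι | ∑ k, Pi.single ((Fin.cons x s : Fin (n + 1) → ι) k) 1 =
            Pi.single x 1 + N'} = {s | ∑ k, Pi.single (s k) 1 = N'} := by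
          ext s
          simp [Fin.sum_univ_succ]
        rw [e, ih N' hN', div_mul_eq_mul_div]
        have : ((((Pi.single x 1 + N' : ι → ℕ) x) : ℕ) : ℝ) = N' x + 1 := by
          simp [add_comm]
        rw [this, h]
        field_simp
    push_cast
    simp_rw [key]
    rw [← Finset.mul_sum]
    have : ∑ i, (N i : ℝ) = n + 1 := by exact_mod_cast hN
    rw [this]
    field_simp

end Words

/-! ### Counting histograms with prescribed sum -/

section Histogram

variable {n : ℕ}

/-- The number of times each value is taken. -/
def histogram (d : Fin n → ℕ) (k : ℕ) : ℕ := (Finset.univ.filter fun i => d i = k).card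

/-- At most `√M` entries can exceed `√M`. The histogram is therefore determined by its values up to
`√M` together with a list of at most `√M` large entries. A cruder bound with about `n` free values
would not be subexponential. -/
theorem ncard_histogram_le (n M : ℕ) :
    (histogram '' {d : Fin n → ℕ | ∑ i, d i = M}).ncard ≤
      (n + 1) ^ (M.sqrt + 1) * (M + 1) ^ M.sqrt := by
  classical
  set s := M.sqrt with hs
  let decode : (Fin (s + 1) → Fin (n + 1)) × (Fin s → Fin (M + 1)) → ℕ → ℕ := fun y k =>
    if h : k < s + 1 then y.1 ⟨k, h⟩ else (Finset.univ.filter fun j => (y.2 j : ℕ) = k).card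
  have hcard : (Set.univ : Set ((Fin (s + 1) → Fin (n + 1)) × (Fin s → Fin (M + 1)))).ncard =
      (n + 1) ^ (s + 1) * (M + 1) ^ s := by
    rw [Set.ncard_univ]
    simp
  rw [← hcard]
  refine le_trans (Set.ncard_le_ncard (t := decode '' Set.univ) ?_ (Set.toFinite _))
    (Set.ncard_image_le (Set.toFinite _))
  rintro _ ⟨d, hd, rfl⟩
  have hd : ∑ i, d i = M := hd
  have hdM : ∀ i, d i ≤ M := fun i =>
    hd ▸ Finset.single_le_sum (f := d) (fun _ _ => Nat.zero_le _) (Finset.mem_univ i)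
  have hlarge : Fintype.card {i // s < d i} ≤ Fintype.card (Fin s) := by
    rw [Fintype.card_subtype, Fintype.card_fin]
    by_contra! hcon
    have h1 : (Finset.univ.filter fun i => s < d i).card * (s + 1) ≤ ∑ i, d i := by
      rw [← smul_eq_mul]
      refine (Finset.card_nsmul_le_sum _ d _ ?_).trans
        (Finset.sum_le_sum_of_subset (Finset.subset_univ _))
      intro i hi
      exact (Finset.mem_filter.1 hi).2
    have h2 : (s + 1) * (s + 1) ≤ (Finset.univ.filter fun i => s < d i).card * (s + 1) := by
      gcongr
      omega
    have h3 := Nat.lt_succ_sqrt M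
    simp only [← hs, Nat.succ_eq_add_one] at h3
    omega
  obtain ⟨e⟩ := Function.Embedding.nonempty_of_card_le hlarge
  -- Unused slots of the list are filled with `0`, which is never counted because the list is read
  -- only at `k ≥ s + 1`.
  refine ⟨(fun k => ⟨histogram d k, ?_⟩, fun j =>
    if h : ∃ i, e i = j then ⟨d (h.choose : Fin n), Nat.lt_succ_of_le (hdM _)⟩ else 0), trivial, ?_⟩
  · refine Nat.lt_succ_of_le ((Finset.card_filter_le _ _).trans ?_)
    simp
  · funext k
    simp only [decode]
    split_ifs with hk
    · rfl
    · unfold histogram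
      symm
      refine Finset.card_bij' (fun i hi => e ⟨i, ?_⟩)
        (fun j hj => if h : ∃ i, e i = j then (h.choose : Fin n) else ?_) ?_ ?_ ?_ ?_
      · have := (Finset.mem_filter.1 hi).2
        omega
      · exfalso
        have := (Finset.mem_filter.1 hj).2
        simp only [h, dite_false] at this
        simp at this
        omega
      · intro i hi
        have hsi : s < d i := by have := (Finset.mem_filter.1 hi).2; omega
        have hex : ∃ i', e i' = e ⟨i, hsi⟩ := ⟨⟨i, hsi⟩, rfl⟩
        have hch := e.injective hex.choose_spec
        simp only [Finset.mem_filter, Finset.mem_univ, true_and]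
        rw [dif_pos hex, hch]
        exact (Finset.mem_filter.1 hi).2
      · intro j hj
        have hj' := (Finset.mem_filter.1 hj).2
        split_ifs at hj' ⊢ with h
        · simpa using hj'
        · simp at hj'
          omega
      · intro i hi
        have hsi : s < d i := by have := (Finset.mem_filter.1 hi).2; omega
        have hex : ∃ i', e i' = e ⟨i, hsi⟩ := ⟨⟨i, hsi⟩, rfl⟩
        have hch := e.injective hex.choose_spec
        rw [dif_pos hex, hch]
      · intro j hj
        have hj' := (Finset.mem_filter.1 hj).2
        split_ifs at hj' with h
        · simp only [h, dite_true]
          exact h.choose_spec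
        · simp at hj'
          omega

theorem sum_histogram_mul (d : Fin n → ℕ) (S : Finset ℕ) (hS : ∀ i, d i ∈ S) (g : ℕ → ℝ) :
    ∑ k ∈ S, histogram d k * g k = ∑ i, g (d i) := by
  rw [← Finset.sum_fiberwise_of_maps_to (g := d) (t := S) (fun i _ => hS i)]
  refine Finset.sum_congr rfl fun k _ => ?_
  rw [histogram, ← nsmul_eq_mul, ← Finset.sum_const]
  exact Finset.sum_congr rfl fun i hi => by rw [(Finset.mem_filter.1 hi).2]

end Histogram

/-! ### Empirical measures and the method of types -/

section Empirical

open InformationTheory ProbabilityTheory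

/-- The empirical measure of a finite family of natural numbers. -/
def empirical {V : Type*} [Fintype V] (d : V → ℕ) : Measure ℕ :=
  (Fintype.card V : ℝ≥0∞)⁻¹ • ∑ v : V, Measure.dirac (d v)

instance isProbabilityMeasure_empirical {V : Type*} [Fintype V] [Nonempty V] (d : V → ℕ) :
    IsProbabilityMeasure (empirical d) := by
  constructor
  simp only [empirical, Measure.smul_apply, Measure.coe_finsetSum, Finset.sum_apply,
    measure_univ, Finset.sum_const, Finset.card_univ, nsmul_eq_mul, mul_one, smul_eq_mul]
  exact ENNReal.inv_mul_cancel (by simp) (by simp)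

theorem degreeDistribution_eq_empirical {V : Type*} [Fintype V] (G : SimpleGraph V) :
    degreeDistribution G = empirical fun v => (G.neighborSet v).ncard := by
  classical
  unfold degreeDistribution empirical
  congr 1
  refine Finset.sum_congr rfl fun v _ => ?_
  congr 1
  rw [← SimpleGraph.card_neighborFinset_eq_degree, ← Set.ncard_coe_finset,
    SimpleGraph.coe_neighborFinset]

theorem empirical_real_singleton {n : ℕ} (d : Fin n → ℕ) (k : ℕ) :
    (empirical d).real {k} = histogram d k / n := by
  classical
  have : ∑ x, (Measure.dirac (d x) : Measure ℕ) {k} = (histogram d k : ℝ≥0∞) := by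
    rw [histogram, Finset.card_filter]
    push_cast
    refine Finset.sum_congr rfl fun i _ => ?_
    simp [Set.indicator]
  rw [measureReal_def, empirical, Measure.smul_apply, Measure.coe_finsetSum, Finset.sum_apply, this]
  simp [div_eq_inv_mul]

theorem lintegral_empirical {n : ℕ} (d : Fin n → ℕ) (f : ℕ → ℝ≥0∞) :
    ∫⁻ k, f k ∂(empirical d) = (n : ℝ≥0∞)⁻¹ * ∑ i, f (d i) := by
  rw [empirical, lintegral_smul_measure, lintegral_finsetSum_measure]
  simp [lintegral_dirac]

theorem integral_empirical {n : ℕ} (d : Fin n → ℕ) (f : ℕ → ℝ) :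
    ∫ k, f k ∂(empirical d) = (n : ℝ)⁻¹ * ∑ i, f (d i) := by
  rw [empirical, integral_smul_measure, integral_finsetSum_measure]
  · simp
  · exact fun i _ => integrable_dirac (by simp)

theorem klDiv_empirical {n : ℕ} [NeZero n] (d : Fin n → ℕ) {c : ℝ≥0} (hc : 0 < c) :
    klDiv (empirical d) (poissonMeasure c) = ENNReal.ofReal ((n : ℝ)⁻¹ *
      ∑ i, Real.log ((empirical d).real {d i} / (poissonMeasure c).real {d i})) := by
  have hint : Integrable (llr (empirical d) (poissonMeasure c)) (empirical d) := by
    refine Integrable.smul_measure ?_ (by simp [NeZero.ne])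
    exact integrable_finsetSum_measure.2 fun i _ => integrable_dirac (by simp)
  rw [klDiv_of_ac_of_integrable (absolutelyContinuous_poissonMeasure hc _) hint, integral_empirical]
  simp [llr, toReal_rnDeriv_poissonMeasure hc]

/-- The total Poisson weight of the degree sequences of a given sum whose empirical measure has
relative entropy at least `a`. -/
theorem sum_prod_poissonMeasure_le {n : ℕ} [NeZero n] {c : ℝ≥0} (hc : 0 < c) (M : ℕ) {a : ℝ≥0}
    (D : Finset (Fin n → ℕ)) (hM : ∀ d ∈ D, ∑ i, d i = M)
    (ha : ∀ d ∈ D, (a : ℝ≥0∞) ≤ klDiv (empirical d) (poissonMeasure c)) :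
    ∑ d ∈ D, ∏ i, (poissonMeasure c).real {d i} ≤
      ((n + 1) ^ (M.sqrt + 1) * (M + 1) ^ M.sqrt : ℕ) * Real.exp (-(n * a)) := by
  classical
  have hn : (0 : ℝ) < n := by exact_mod_cast NeZero.pos n
  have hcard : (D.image histogram).card ≤ (n + 1) ^ (M.sqrt + 1) * (M + 1) ^ M.sqrt := by
    rw [← Set.ncard_coe_finset, Finset.coe_image]
    refine (Set.ncard_le_ncard (Set.image_mono fun d hd => hM d hd) ?_).trans
      (ncard_histogram_le n M)
    refine Set.Finite.image _ ?_
    refine (Set.finite_Iic (fun _ : Fin n => M)).subset fun d hd i => ?_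
    have hd : ∑ i, d i = M := hd
    exact hd ▸ Finset.single_le_sum (f := d) (fun _ _ => Nat.zero_le _) (Finset.mem_univ i)
  have hfib : ∀ h ∈ D.image histogram,
      ∑ d ∈ D with histogram d = h, ∏ i, (poissonMeasure c).real {d i} ≤
        Real.exp (-(n * a)) := by
    intro h hh
    -- Within a type class, the Poisson weight of `d` is `exp (-n H)` times its weight under the
    -- `n`-fold product of its own empirical law.
    have hle : ∀ d ∈ D.filter (fun d => histogram d = h), ∏ i, (poissonMeasure c).real {d i} ≤
        Real.exp (-(n * a)) * ∏ i, ((h (d i) : ℝ) / n) := by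
      intro d hd
      obtain ⟨hdD, rfl⟩ := Finset.mem_filter.1 hd
      have hν : ∀ i, 0 < (histogram d (d i) : ℝ) / n := by
        intro i
        have : 0 < histogram d (d i) := Finset.card_pos.2 ⟨i, by simp⟩
        positivity
      have hq : ∀ i, 0 < (poissonMeasure c).real {d i} :=
        fun i => poissonMeasure_real_singleton_pos _ hc
      have h1 := ha d hdD
      rw [klDiv_empirical d hc] at h1
      rw [← ENNReal.ofReal_coe_nnreal, ENNReal.ofReal_le_ofReal_iff'] at h1
      have h2 : (n : ℝ) * a ≤
          ∑ i, Real.log ((empirical d).real {d i} / (poissonMeasure c).real {d i}) := by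
        -- The truncation in `ENNReal.ofReal` leaves the case `a = 0`, where nonnegativity of the
        -- relative entropy is what is needed.
        rcases h1 with h1 | h1
        · rw [inv_mul_eq_div, le_div_iff₀ hn] at h1
          linarith
        · have ha0 : (a : ℝ) = 0 := le_antisymm h1 a.2
          rw [ha0, mul_zero]
          have hnn := toReal_klDiv_of_measure_eq
            (absolutelyContinuous_poissonMeasure hc (empirical d)) (by simp)
          rw [integral_empirical] at hnn
          have : 0 ≤ (n : ℝ)⁻¹ * ∑ i, llr (empirical d) (poissonMeasure c) (d i) := by
            rw [← hnn]
            exact ENNReal.toReal_nonneg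
          rw [inv_mul_eq_div, le_div_iff₀ hn, zero_mul] at this
          simpa [llr, toReal_rnDeriv_poissonMeasure hc] using this
      have h4 : ∏ i, (poissonMeasure c).real {d i} =
          Real.exp (-∑ i, Real.log ((empirical d).real {d i} / (poissonMeasure c).real {d i})) *
          ∏ i, ((histogram d (d i) : ℝ) / n) := by
        rw [← Finset.sum_neg_distrib, Real.exp_sum, ← Finset.prod_mul_distrib]
        refine Finset.prod_congr rfl fun i _ => ?_
        rw [empirical_real_singleton, ← Real.log_inv, Real.exp_log (inv_pos.2 (div_pos (hν i) (hq i))),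
          inv_div]
        have := (div_ne_zero_iff.1 (hν i).ne').1
        field_simp
      rw [h4]
      have h5 : (0 : ℝ) ≤ ∏ i, ((histogram d (d i) : ℝ) / n) :=
        Finset.prod_nonneg fun i _ => (hν i).le
      gcongr
    refine (Finset.sum_le_sum hle).trans ?_
    rw [← Finset.mul_sum]
    refine mul_le_of_le_one_right (Real.exp_pos _).le ?_
    obtain ⟨d₀, hd₀, rfl⟩ := Finset.mem_image.1 hh
    -- Extended to a full box, the sum factorises into the `n`-th power of the total mass of the
    -- empirical law.
    calc ∑ d ∈ D with histogram d = histogram d₀, ∏ i, ((histogram d₀ (d i) : ℝ) / n)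
        ≤ ∑ d ∈ Fintype.piFinset fun _ : Fin n => Finset.range (M + 1),
            ∏ i, ((histogram d₀ (d i) : ℝ) / n) := by
          refine Finset.sum_le_sum_of_subset_of_nonneg ?_ fun d _ _ =>
            Finset.prod_nonneg fun i _ => by positivity
          intro d hd
          rw [Fintype.mem_piFinset]
          intro i
          have := hM d (Finset.mem_filter.1 hd).1
          rw [Finset.mem_range, Nat.lt_succ_iff, ← this]
          exact Finset.single_le_sum (f := d) (fun _ _ => Nat.zero_le _) (Finset.mem_univ i)
      _ = (∑ k ∈ Finset.range (M + 1), (histogram d₀ k : ℝ) / n) ^ n := by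
          rw [Finset.sum_prod_piFinset (Finset.range (M + 1))
            (fun _ k => (histogram d₀ k : ℝ) / n)]
          simp
      _ ≤ 1 := by
          have hS : ∀ i, d₀ i ∈ Finset.range (M + 1) := by
            intro i
            have := hM d₀ hd₀
            rw [Finset.mem_range, Nat.lt_succ_iff, ← this]
            exact Finset.single_le_sum (f := d₀) (fun _ _ => Nat.zero_le _) (Finset.mem_univ i)
          have := sum_histogram_mul d₀ (Finset.range (M + 1)) hS (fun _ => (n : ℝ)⁻¹)
          simp only [← div_eq_mul_inv] at this
          rw [this]
          simp [hn.ne']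
  rw [← Finset.sum_fiberwise_of_maps_to (g := histogram) (t := D.image histogram)
    (fun d hd => Finset.mem_image_of_mem _ hd)]
  refine (Finset.sum_le_sum hfib).trans ?_
  rw [Finset.sum_const, nsmul_eq_mul]
  gcongr

end Empirical

/-! ### Upper and lower bounds at fixed `n` -/

section FiniteBounds

open InformationTheory ProbabilityTheory

/-- The number of sequences of `m` distinct edges on `Fin n` whose degree sequence satisfies `P`. -/
def simpleSeqCount (n m : ℕ) (P : (Fin n → ℕ) → Prop) : ℕ :=
  {s : Fin m → Fin n × Fin n | IsSimpleSeq ∅ s ∧ P (endpointCount s)}.ncard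

theorem probDegreeDistributionMem_eq (n m : ℕ) (Γ : Set (ProbabilityMeasure ℕ)) :
    probDegreeDistributionMem n m Γ =
      (simpleSeqCount n m fun d => ∃ p ∈ Γ, (p : Measure ℕ) = empirical d : ℝ≥0∞) /
        (simpleSeqCount n m fun _ => True : ℝ≥0∞) := by
  have h1 := ncard_graphs_mul (V := Fin n) m fun d => ∃ p ∈ Γ, (p : Measure ℕ) = empirical d
  have h2 := ncard_graphs_mul (V := Fin n) m fun _ => True
  have e1 : {G ∈ graphsWithEdges n m | ∃ p ∈ Γ, (p : Measure ℕ) = degreeDistribution G} =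
      {G : SimpleGraph (Fin n) | G.edgeSet.ncard = m ∧
        ∃ p ∈ Γ, (p : Measure ℕ) = empirical fun i => (G.neighborSet i).ncard} := by
    ext G
    simp [graphsWithEdges, degreeDistribution_eq_empirical]
  have e2 : graphsWithEdges n m = {G : SimpleGraph (Fin n) | G.edgeSet.ncard = m ∧ True} := by
    ext G
    simp [graphsWithEdges]
  unfold probDegreeDistributionMem simpleSeqCount
  rw [← h1, ← h2, e1, ← e2]
  push_cast
  refine (ENNReal.mul_div_mul_right _ _ ?_ ?_).symm
  · have := Nat.factorial_ne_zero m
    simp [this]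
  · exact_mod_cast ENNReal.natCast_ne_top (m.factorial * 2 ^ m)

theorem simpleSeqCount_mono {n m : ℕ} {P Q : (Fin n → ℕ) → Prop} (h : ∀ d, P d → Q d) :
    simpleSeqCount n m P ≤ simpleSeqCount n m Q :=
  Set.ncard_le_ncard (fun _ hs => ⟨hs.1, h _ hs.2⟩) (Set.toFinite _)

theorem simpleSeqCount_le (n m : ℕ) (P : (Fin n → ℕ) → Prop) :
    simpleSeqCount n m P ≤ (n ^ 2) ^ m := by
  refine (Set.ncard_le_ncard (Set.subset_univ _) (Set.toFinite _)).trans ?_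
  rw [Set.ncard_univ]
  simp [sq]

theorem pow_le_simpleSeqCount_true (n m : ℕ) :
    (n * (n - 1) - 2 * m) ^ m ≤ simpleSeqCount n m fun _ => True := by
  have h := pow_le_ncard_isSimpleSeq (V := Fin n) m ∅
  simpa [simpleSeqCount] using h

theorem probDegreeDistributionMem_le_one (n m : ℕ) (Γ : Set (ProbabilityMeasure ℕ)) :
    probDegreeDistributionMem n m Γ ≤ 1 := by
  rw [probDegreeDistributionMem_eq]
  refine ENNReal.div_le_of_le_mul ?_
  rw [one_mul]
  exact_mod_cast simpleSeqCount_mono fun _ _ => trivial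

/-- This is where the Poisson law enters: in `∏ q_c(d i)` the powers of `c` and the exponentials
depend only on `M` and `n`, leaving `1 / ∏ (d i)!`. -/
theorem arrangements_eq_prod_poissonMeasure {n : ℕ} {c : ℝ≥0} (hc : 0 < c) (d : Fin n → ℕ) {M : ℕ}
    (hd : ∑ i, d i = M) :
    arrangements d = M.factorial * Real.exp (n * c) / (c : ℝ) ^ M *
      ∏ i, (poissonMeasure c).real {d i} := by
  have hc' : (0 : ℝ) < c := hc
  have hpos : 0 < ∏ i, ((d i).factorial : ℝ) :=
    Finset.prod_pos fun i _ => by exact_mod_cast Nat.factorial_pos _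
  simp only [poissonMeasure_real_singleton]
  rw [Finset.prod_div_distrib, Finset.prod_mul_distrib, Finset.prod_pow_eq_pow_sum, hd,
    Finset.prod_const, Finset.card_univ, Fintype.card_fin, ← Real.exp_nat_mul, arrangements, hd]
  have : Real.exp (n * c) * Real.exp (-(n * c)) = 1 := by
    rw [← Real.exp_add]; simp
  field_simp
  exact this.symm

/-- Simplicity is discarded here; only the multinomial count and the bound by types remain. -/
theorem simpleSeqCount_le_sum {n m : ℕ} [NeZero n] {c : ℝ≥0} (hc : 0 < c)
    (P : (Fin n → ℕ) → Prop) {a : ℝ≥0} (ha : ∀ d : Fin n → ℕ, ∑ i, d i = 2 * m → P d →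
      (a : ℝ≥0∞) ≤ klDiv (empirical d) (poissonMeasure c)) :
    (simpleSeqCount n m P : ℝ) ≤ (2 * m).factorial * Real.exp (n * c) / (c : ℝ) ^ (2 * m) *
      (((n + 1) ^ ((2 * m).sqrt + 1) * (2 * m + 1) ^ (2 * m).sqrt : ℕ) * Real.exp (-(n * a))) := by
  classical
  set S : Finset (Fin m → Fin n × Fin n) := Finset.univ.filter fun s => P (endpointCount s) with hS
  set D := S.image endpointCount with hD
  have hDm : ∀ d ∈ D, ∑ i, d i = 2 * m ∧ P d := by
    intro d hd
    obtain ⟨s, hs, rfl⟩ := Finset.mem_image.1 hd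
    exact ⟨sum_endpointCount s, (Finset.mem_filter.1 hs).2⟩
  have h1 : simpleSeqCount n m P ≤ S.card := by
    rw [← Set.ncard_coe_finset]
    refine Set.ncard_le_ncard (fun s hs => ?_) (Set.toFinite _)
    simpa [hS] using hs.2
  have h2 : (S.card : ℝ) ≤ ∑ d ∈ D, arrangements d := by
    rw [Finset.card_eq_sum_card_fiberwise (f := endpointCount) (t := D)
      (fun s hs => Finset.mem_image_of_mem _ hs)]
    push_cast
    refine Finset.sum_le_sum fun d hd => ?_
    rw [← ncard_endpointCount_eq m d (hDm d hd).1]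
    norm_cast
    rw [← Set.ncard_coe_finset]
    refine Set.ncard_le_ncard (fun s hs => ?_) (Set.toFinite _)
    simpa using (Finset.mem_filter.1 hs).2
  refine (Nat.cast_le.2 h1).trans (h2.trans ?_)
  rw [Finset.sum_congr rfl fun d hd => arrangements_eq_prod_poissonMeasure hc d (hDm d hd).1,
    ← Finset.mul_sum]
  refine mul_le_mul_of_nonneg_left ?_ (by positivity)
  exact sum_prod_poissonMeasure_le hc (2 * m) D (fun d hd => (hDm d hd).1)
    fun d hd => ha d (hDm d hd).1 (hDm d hd).2

/-- A degree distribution with `m` edges has mean exactly `2m/n`, so the entropy bound is only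
required of laws in `Γ` with that mean. -/
theorem probDegreeDistributionMem_le {n m : ℕ} [NeZero n] {c : ℝ≥0} (hc : 0 < c)
    {Γ : Set (ProbabilityMeasure ℕ)} {a : ℝ≥0} (hm : 2 * m < n * (n - 1))
    (ha : ∀ p ∈ Γ, firstMoment p = (n : ℝ≥0∞)⁻¹ * (2 * m : ℕ) →
      (a : ℝ≥0∞) ≤ klDiv (p : Measure ℕ) (poissonMeasure c)) :
    probDegreeDistributionMem n m Γ ≤ ENNReal.ofReal
      ((2 * m).factorial * Real.exp (n * c) / (c : ℝ) ^ (2 * m) *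
      (((n + 1) ^ ((2 * m).sqrt + 1) * (2 * m + 1) ^ (2 * m).sqrt : ℕ) * Real.exp (-(n * a))) /
      ((n * (n - 1) - 2 * m : ℕ) : ℝ) ^ m) := by
  have hpos : (0 : ℝ) < ((n * (n - 1) - 2 * m : ℕ) : ℝ) ^ m := by
    have : 0 < n * (n - 1) - 2 * m := by omega
    positivity
  rw [probDegreeDistributionMem_eq, ENNReal.ofReal_div_of_pos hpos]
  gcongr
  · rw [← ENNReal.ofReal_natCast]
    refine ENNReal.ofReal_le_ofReal (simpleSeqCount_le_sum hc _ ?_)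
    rintro d hd ⟨p, hp, hpd⟩
    rw [← hpd]
    refine ha p hp ?_
    rw [← lintegral_natCast_eq_firstMoment, hpd, lintegral_empirical, ← hd]
    push_cast
    rfl
  · rw [← Nat.cast_pow, ENNReal.ofReal_natCast]
    exact_mod_cast pow_le_simpleSeqCount_true n m

/-- A value can change only at a vertex touched by `b` or `b'`, and together these have `4 * J`
endpoints. -/
theorem abs_histogram_sub_le {n J : ℕ} {d d' : Fin n → ℕ} {b b' : Fin J → Fin n × Fin n}
    (h : d' + endpointCount b = d + endpointCount b') (k : ℕ) :
    |(histogram d' k : ℝ) - histogram d k| ≤ 4 * J := by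
  have key : ∀ (d d' : Fin n → ℕ) (b b' : Fin J → Fin n × Fin n),
      d' + endpointCount b = d + endpointCount b' → histogram d' k ≤ histogram d k + 4 * J := by
    intro d d' b b' h
    have hsub : (Finset.univ.filter fun i => d' i = k) ⊆ (Finset.univ.filter fun i => d i = k) ∪
        Finset.univ.filter fun i => 1 ≤ endpointCount b i + endpointCount b' i := by
      intro i
      have hi := congrFun h i
      simp only [Pi.add_apply] at hi
      simp only [Finset.mem_filter, Finset.mem_univ, true_and, Finset.mem_union]
      omega
    refine (Finset.card_le_card hsub).trans ((Finset.card_union_le _ _).trans ?_)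
    refine Nat.add_le_add_left ?_ _
    calc (Finset.univ.filter fun i => 1 ≤ endpointCount b i + endpointCount b' i).card
        ≤ ∑ i, (endpointCount b i + endpointCount b' i) := by
          rw [Finset.card_eq_sum_ones]
          refine (Finset.sum_le_sum fun i hi => (Finset.mem_filter.1 hi).2).trans ?_
          exact Finset.sum_le_sum_of_subset (Finset.subset_univ _)
      _ = 4 * J := by
          rw [Finset.sum_add_distrib, sum_endpointCount, sum_endpointCount]
          ring
  rw [abs_le]
  have h1 := key d d' b b' h
  have h2 := key d' d b' b h.symm
  have h1' : (histogram d' k : ℝ) ≤ histogram d k + 4 * J := by exact_mod_cast h1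
  have h2' : (histogram d k : ℝ) ≤ histogram d' k + 4 * J := by exact_mod_cast h2
  constructor <;> linarith

/-- There are `arrangements N` degree sequences with occupation numbers `N`, all with the same
multinomial count. They contribute disjoint sets of arrangements with simple first `t` pairs, and
these are then patched. -/
theorem le_simpleSeqCount {n K t J : ℕ} (N : Fin (K + 1) → ℕ) (hN : ∑ k, N k = n)
    (hM : ∑ k : Fin (K + 1), (k : ℕ) * N k = 2 * (t + J)) (hJ : K + K ^ 2 ≤ 2 * J)
    (hm : 2 * (t + J) < n * (n - 1)) (P : (Fin n → ℕ) → Prop)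
    (hP : ∀ d : Fin n → ℕ, (∀ k : Fin (K + 1), |(histogram d k : ℝ) - N k| ≤ 4 * J) → P d) :
    arrangements N * ((1 - (K + K ^ 2 : ℝ) / (2 * J)) ^ t *
      ((2 * (t + J)).factorial / ∏ k : Fin (K + 1), ((k : ℕ).factorial : ℝ) ^ N k)) ≤
      simpleSeqCount n (t + J) P * ((n : ℝ) ^ 2) ^ J := by
  classical
  set W : Finset (Fin n → Fin (K + 1)) := Finset.univ.filter fun w => ∑ i, Pi.single (w i) 1 = N
    with hW
  set D : Finset (Fin n → ℕ) := W.image fun w i => (w i : ℕ) with hD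
  have hWc : (W.card : ℝ) = arrangements N := by
    rw [← ncard_words_eq n N hN, ← Set.ncard_coe_finset]
    congr 2
    ext w
    simp [hW]
  have hDc : D.card = W.card := by
    refine Finset.card_image_of_injective _ fun w w' h => ?_
    funext i
    exact Fin.ext (congrFun h i)
  have hcount : ∀ w ∈ W, ∀ k, (Finset.univ.filter fun i => w i = k).card = N k := by
    intro w hw k
    have := congrFun (Finset.mem_filter.1 hw).2 k
    rw [← this, Finset.sum_apply, Finset.card_filter]
    refine Finset.sum_congr rfl fun i _ => ?_
    simp [Pi.single_apply, eq_comm]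
  have hDK : ∀ d ∈ D, (∀ i, d i ≤ K) ∧ ∑ i, d i = 2 * (t + J) ∧
      (∀ k : Fin (K + 1), histogram d k = N k) ∧
      arrangements d = (2 * (t + J)).factorial / ∏ k : Fin (K + 1), ((k : ℕ).factorial : ℝ) ^ N k := by
    intro d hd
    obtain ⟨w, hw, rfl⟩ := Finset.mem_image.1 hd
    have hsum : ∑ i, (w i : ℕ) = 2 * (t + J) := by
      rw [← hM, ← Finset.sum_fiberwise (g := w)]
      refine Finset.sum_congr rfl fun k _ => ?_
      rw [← hcount w hw k, mul_comm, ← smul_eq_mul, ← Finset.sum_const]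
      exact Finset.sum_congr rfl fun i hi => by rw [(Finset.mem_filter.1 hi).2]
    refine ⟨fun i => Nat.lt_succ_iff.1 (w i).2, hsum, fun k => ?_, ?_⟩
    · rw [← hcount w hw k]
      simp [histogram, Fin.ext_iff]
    · rw [arrangements, hsum]
      congr 1
      rw [← Finset.prod_fiberwise (g := w)]
      refine Finset.prod_congr rfl fun k _ => ?_
      rw [← hcount w hw k, ← Finset.prod_const]
      exact Finset.prod_congr rfl fun i hi => by rw [(Finset.mem_filter.1 hi).2]
  have h1 := ncard_le_mul_ncard_patched (V := Fin n) (t := t) (J := J) (D : Set (Fin n → ℕ))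
    (by simpa using hm)
  have h2 : {s : Fin (t + J) → Fin n × Fin n | IsSimpleSeq ∅ s ∧ ∃ d ∈ (D : Set (Fin n → ℕ)),
      ∃ b b' : Fin J → Fin n × Fin n, endpointCount s + endpointCount b =
        d + endpointCount b'}.ncard ≤ simpleSeqCount n (t + J) P := by
    refine Set.ncard_le_ncard ?_ (Set.toFinite _)
    rintro s ⟨hs, d, hd, b, b', hb⟩
    refine ⟨hs, hP _ fun k => ?_⟩
    rw [← (hDK d hd).2.2.1 k]
    exact abs_histogram_sub_le hb k
  have h3 : ∑ d ∈ D, {ab : (Fin t → Fin n × Fin n) × (Fin J → Fin n × Fin n) |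
      IsSimpleSeq ∅ ab.1 ∧ endpointCount ab.1 + endpointCount ab.2 = d}.ncard ≤
      {ab : (Fin t → Fin n × Fin n) × (Fin J → Fin n × Fin n) |
      IsSimpleSeq ∅ ab.1 ∧ endpointCount ab.1 + endpointCount ab.2 ∈ (D : Set (Fin n → ℕ))}.ncard := by
    rw [Set.ncard_eq_toFinset_card' {ab : (Fin t → Fin n × Fin n) × (Fin J → Fin n × Fin n) |
      IsSimpleSeq ∅ ab.1 ∧ endpointCount ab.1 + endpointCount ab.2 ∈ (D : Set (Fin n → ℕ))},
      Finset.card_eq_sum_card_fiberwise (f := fun ab => endpointCount ab.1 + endpointCount ab.2)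
      (t := D) (fun ab hab => by simpa using (by simpa using hab : _ ∧ _).2)]
    refine Finset.sum_le_sum fun d hd => ?_
    rw [← Set.ncard_coe_finset]
    refine Set.ncard_le_ncard ?_ (Set.toFinite _)
    rintro ab ⟨hab, rfl⟩
    simpa using ⟨hab, hd⟩
  have h4 : ∀ d ∈ D, (1 - (K + K ^ 2 : ℝ) / (2 * J)) ^ t *
      ((2 * (t + J)).factorial / ∏ k : Fin (K + 1), ((k : ℕ).factorial : ℝ) ^ N k) ≤
      {ab : (Fin t → Fin n × Fin n) × (Fin J → Fin n × Fin n) |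
      IsSimpleSeq ∅ ab.1 ∧ endpointCount ab.1 + endpointCount ab.2 = d}.ncard := by
    intro d hd
    rw [← (hDK d hd).2.2.2]
    exact le_ncard_isSimpleSeq_endpointCount K t J ∅ d (hDK d hd).2.1 hJ
      (fun i => by simpa using (hDK d hd).1 i)
  have h5 := Finset.sum_le_sum h4
  rw [Finset.sum_const, nsmul_eq_mul, hDc, hWc] at h5
  refine h5.trans ?_
  have h6 := h3.trans (h1.trans (Nat.mul_le_mul_right _ h2))
  rw [Fintype.card_fin] at h6
  exact_mod_cast h6

theorem le_probDegreeDistributionMem {n K t J : ℕ} [NeZero n] (N : Fin (K + 1) → ℕ)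
    (hN : ∑ k, N k = n) (hM : ∑ k : Fin (K + 1), (k : ℕ) * N k = 2 * (t + J)) (hJ : K + K ^ 2 ≤ 2 * J)
    (hm : 2 * (t + J) < n * (n - 1)) {Γ : Set (ProbabilityMeasure ℕ)}
    (hΓ : ∀ p : ProbabilityMeasure ℕ,
      (∀ k : Fin (K + 1), |(p : Measure ℕ).real {(k : ℕ)} - N k / n| ≤ 4 * J / n) → p ∈ Γ) :
    ENNReal.ofReal (arrangements N * ((1 - (K + K ^ 2 : ℝ) / (2 * J)) ^ t *
      ((2 * (t + J)).factorial / ∏ k : Fin (K + 1), ((k : ℕ).factorial : ℝ) ^ N k)) /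
      ((n : ℝ) ^ (2 * J) * (n : ℝ) ^ (2 * (t + J)))) ≤ probDegreeDistributionMem n (t + J) Γ := by
  have hn : (0 : ℝ) < n := by exact_mod_cast NeZero.pos n
  have h := le_simpleSeqCount N hN hM hJ hm
    (fun d => ∃ p ∈ Γ, (p : Measure ℕ) = empirical d) (fun d hd =>
      ⟨⟨empirical d, inferInstance⟩, hΓ _ fun k => ?_, rfl⟩)
  · rw [probDegreeDistributionMem_eq, ← div_div, ENNReal.ofReal_div_of_pos (by positivity)]
    gcongr
    · rw [← ENNReal.ofReal_natCast]
      refine ENNReal.ofReal_le_ofReal ?_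
      rw [div_le_iff₀ (by positivity), pow_mul]
      exact h
    · have h3 := simpleSeqCount_le n (t + J) fun _ => True
      rw [← pow_mul] at h3
      rw [← Nat.cast_pow, ENNReal.ofReal_natCast]
      exact_mod_cast h3
  · change |(empirical d).real {(k : ℕ)} - N k / n| ≤ _
    rw [empirical_real_singleton, ← sub_div, abs_div, abs_of_pos hn]
    gcongr
    exact hd k

end FiniteBounds

/-! ### Elementary estimates for logarithms and factorials -/

section Logarithms

theorem le_log_factorial (n : ℕ) : n * Real.log n - n ≤ Real.log n.factorial := by
  induction n with
  | zero => simp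
  | succ n ih =>
    have h0 : (0 : ℝ) < n + 1 := by positivity
    rw [Nat.factorial_succ]
    push_cast
    rw [Real.log_mul h0.ne' (by exact_mod_cast Nat.factorial_ne_zero n)]
    rcases Nat.eq_zero_or_pos n with rfl | hn
    · simp
    · have hn' : (0 : ℝ) < n := by exact_mod_cast hn
      have h1 := Real.log_le_sub_one_of_pos (x := (n + 1 : ℝ) / n) (by positivity)
      rw [Real.log_div h0.ne' hn'.ne'] at h1
      have h2 : (n : ℝ) * (((n : ℝ) + 1) / n - 1) = 1 := by field_simp; ring
      nlinarith [mul_le_mul_of_nonneg_left h1 hn'.le]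

theorem log_factorial_le (n : ℕ) :
    Real.log n.factorial ≤ (n + 1) * Real.log (n + 1) - n := by
  induction n with
  | zero => simp
  | succ n ih =>
    have h0 : (0 : ℝ) < n + 1 := by positivity
    have h0' : (0 : ℝ) < n + 2 := by positivity
    rw [Nat.factorial_succ]
    push_cast
    rw [Real.log_mul h0.ne' (by exact_mod_cast Nat.factorial_ne_zero n)]
    have h1 := Real.log_le_sub_one_of_pos (x := (n + 1 : ℝ) / (n + 2)) (by positivity)
    rw [Real.log_div h0.ne' h0'.ne'] at h1
    have h2 : (n + 2 : ℝ) * (((n : ℝ) + 1) / (n + 2) - 1) = -1 := by field_simp; ring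
    have h3 : (n : ℝ) + 1 + 1 = n + 2 := by ring
    rw [h3]
    nlinarith [mul_le_mul_of_nonneg_left h1 h0'.le]

theorem neg_two_mul_le_log_one_sub {x : ℝ} (h0 : 0 ≤ x) (h1 : x ≤ 1 / 2) :
    -(2 * x) ≤ Real.log (1 - x) := by
  have hx : 0 < 1 - x := by linarith
  have h := Real.one_sub_inv_le_log_of_pos hx
  refine le_trans ?_ h
  rw [le_sub_iff_add_le, ← le_sub_iff_add_le', inv_le_iff_one_le_mul₀ hx]
  nlinarith

theorem tendsto_log_div_sqrt :
    Tendsto (fun n : ℕ => Real.log ((n : ℝ) + 1) / √((n : ℝ) + 1)) atTop (𝓝 0) := by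
  have h := (isLittleO_log_rpow_atTop (r := 1 / 2) (by norm_num)).tendsto_div_nhds_zero
  have h2 := h.comp (tendsto_atTop_add_const_right atTop (1 : ℝ) tendsto_natCast_atTop_atTop)
  refine h2.congr fun n => ?_
  simp [Real.sqrt_eq_rpow]

/-- Any quantity of order `√n` may appear as an exponent of `n` without effect at speed `n`. This
serves both the number of histograms and the number of patched pairs. -/
theorem tendsto_mul_log_div {u : ℕ → ℝ} (hu0 : ∀ n, 0 ≤ u n) {C : ℝ}
    (hu : ∀ᶠ n : ℕ in atTop, u n ^ 2 ≤ C * (n + 1)) :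
    Tendsto (fun n : ℕ => u n * Real.log ((n : ℝ) + 1) / n) atTop (𝓝 0) := by
  have h := tendsto_log_div_sqrt.const_mul (2 * √C)
  rw [mul_zero] at h
  refine squeeze_zero' ?_ ?_ h
  · filter_upwards with n
    have := Real.log_nonneg (x := (n : ℝ) + 1) (by simp)
    have := hu0 n
    positivity
  · filter_upwards [hu, eventually_ge_atTop 1] with n hn h1
    have hl := Real.log_nonneg (x := (n : ℝ) + 1) (by simp)
    have h1' : (1 : ℝ) ≤ n := by exact_mod_cast h1
    have hs : 0 < √((n : ℝ) + 1) := Real.sqrt_pos.2 (by positivity)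
    have hss : √((n : ℝ) + 1) * √((n : ℝ) + 1) = n + 1 := Real.mul_self_sqrt (by positivity)
    have hu1 : u n ≤ √C * √((n : ℝ) + 1) := by
      rw [← Real.sqrt_mul' _ (by positivity)]
      exact Real.le_sqrt_of_sq_le hn
    have hC := Real.sqrt_nonneg C
    rw [div_le_iff₀ (by positivity)]
    calc u n * Real.log ((n : ℝ) + 1) ≤ √C * √((n : ℝ) + 1) * Real.log ((n : ℝ) + 1) := by gcongr
      _ = √C * (Real.log ((n : ℝ) + 1) / √((n : ℝ) + 1)) *
          (√((n : ℝ) + 1) * √((n : ℝ) + 1)) := by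
          generalize √((n : ℝ) + 1) = z at hs
          field_simp
      _ = √C * (Real.log ((n : ℝ) + 1) / √((n : ℝ) + 1)) * (n + 1) := by rw [hss]
      _ ≤ √C * (Real.log ((n : ℝ) + 1) / √((n : ℝ) + 1)) * (2 * n) := by gcongr; linarith
      _ = _ := by ring

theorem tendsto_log_div : Tendsto (fun n : ℕ => Real.log n / n) atTop (𝓝 0) := by
  have h := (Real.isLittleO_log_id_atTop).tendsto_div_nhds_zero
  exact h.comp tendsto_natCast_atTop_atTop

end Logarithms

/-! ### The normalisation in the upper bound is subexponential -/

section Asymptotics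

variable {c : ℝ≥0} {m : ℕ → ℕ}

theorem eventually_two_mul_lt (C : ℕ)
    (hm : Tendsto (fun n : ℕ => 2 * (m n : ℝ) / (n : ℝ)) atTop (𝓝 (c : ℝ))) :
    ∀ᶠ n : ℕ in atTop, C * n + 2 * m n < n * (n - 1) := by
  filter_upwards [hm.eventually (Iio_mem_nhds (lt_add_one (c : ℝ))),
    eventually_ge_atTop (⌈(c : ℝ)⌉₊ + C + 3)] with n h1 h2
  have h3 : (0 : ℝ) < n := by exact_mod_cast (by omega : 0 < n)
  have h1 : 2 * (m n : ℝ) / n < c + 1 := h1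
  rw [div_lt_iff₀ h3] at h1
  have h4 : (c : ℝ) ≤ ⌈(c : ℝ)⌉₊ := Nat.le_ceil _
  have h5 : 2 * (m n : ℝ) < (⌈(c : ℝ)⌉₊ + 1 : ℕ) * n := by
    push_cast
    nlinarith
  have h6 : 2 * m n < (⌈(c : ℝ)⌉₊ + 1) * n := by exact_mod_cast h5
  have h7 : (⌈(c : ℝ)⌉₊ + 1 + C) * n ≤ (n - 1) * n := by
    gcongr
    omega
  nlinarith

theorem eventually_two_mul_le
    (hm : Tendsto (fun n : ℕ => 2 * (m n : ℝ) / (n : ℝ)) atTop (𝓝 (c : ℝ))) :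
    ∀ᶠ n : ℕ in atTop, 2 * (m n : ℝ) ≤ (c + 1) * n := by
  filter_upwards [hm.eventually (Iio_mem_nhds (lt_add_one (c : ℝ))),
    eventually_ge_atTop 1] with n h1 h2
  have h3 : (0 : ℝ) < n := by exact_mod_cast h2
  have h1 : 2 * (m n : ℝ) / n < c + 1 := h1
  rw [div_lt_iff₀ h3] at h1
  exact h1.le

theorem exists_upper_rate (hc : 0 < c)
    (hm : Tendsto (fun n : ℕ => 2 * (m n : ℝ) / (n : ℝ)) atTop (𝓝 (c : ℝ))) :
    ∃ R : ℕ → ℝ, Tendsto R atTop (𝓝 0) ∧ ∀ᶠ n : ℕ in atTop, ∀ a : ℝ,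
      (2 * m n).factorial * Real.exp (n * c) / (c : ℝ) ^ (2 * m n) *
      (((n + 1) ^ ((2 * m n).sqrt + 1) * (2 * m n + 1) ^ (2 * m n).sqrt : ℕ) *
        Real.exp (-(n * a))) / ((n * (n - 1) - 2 * m n : ℕ) : ℝ) ^ m n ≤
      Real.exp (n * (R n - a)) := by
  have hc' : (0 : ℝ) < c := hc
  have hinv : Tendsto (fun n : ℕ => 1 / (n : ℝ)) atTop (𝓝 0) := tendsto_one_div_atTop_nhds_zero_nat
  set x : ℕ → ℝ := fun n => 2 * (m n : ℝ) / n with hx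
  -- These are chosen so that `2 * m n + 1 = n * y n`, the base in the bound for the factorial, and
  -- `n * (n - 1) - 2 * m n = n ^ 2 * w n`.
  set y : ℕ → ℝ := fun n => x n + 1 / n with hy
  set w : ℕ → ℝ := fun n => 1 - 1 / n - x n * (1 / n) with hw
  have hyt : Tendsto y atTop (𝓝 c) := by
    have := hm.add hinv
    rwa [add_zero] at this
  have hwt : Tendsto w atTop (𝓝 1) := by
    have := (tendsto_const_nhds (x := (1 : ℝ))).sub hinv |>.sub (hm.mul hinv)
    rwa [mul_zero, sub_zero, sub_zero] at this
  have hst : Tendsto (fun n : ℕ => (((2 * m n).sqrt : ℝ) + 1) * Real.log ((n : ℝ) + 1) / n)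
      atTop (𝓝 0) := by
    refine tendsto_mul_log_div (fun n => by positivity) (C := 2 * (c + 2)) ?_
    filter_upwards [eventually_two_mul_le hm] with n hn
    have h1 : ((2 * m n).sqrt : ℝ) * (2 * m n).sqrt ≤ 2 * m n := by
      exact_mod_cast Nat.sqrt_le (2 * m n)
    have h2 : (0 : ℝ) ≤ n := by positivity
    nlinarith [sq_nonneg (((2 * m n).sqrt : ℝ) - 1)]
  -- The terms in `n log n` cancel, and the limits `c log c`, `-c`, `c`, `-c log c` add up to zero.
  -- The factor `3` collects the number of histograms: once from the power of `n + 1` and twice from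
  -- `log (M + 1) ≤ 2 log (n + 1)`.
  refine ⟨fun n => y n * Real.log (y n) + Real.log n / n - x n + c - x n * Real.log c +
    3 * ((((2 * m n).sqrt : ℝ) + 1) * Real.log ((n : ℝ) + 1) / n) - x n / 2 * Real.log (w n),
    ?_, ?_⟩
  · have h1 : Tendsto (fun n => y n * Real.log (y n)) atTop (𝓝 (c * Real.log c)) :=
      hyt.mul ((Real.continuousAt_log hc'.ne').tendsto.comp hyt)
    have h2 : Tendsto (fun n => Real.log (w n)) atTop (𝓝 (Real.log 1)) :=
      (Real.continuousAt_log one_ne_zero).tendsto.comp hwt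
    have := (((((h1.add tendsto_log_div).sub hm).add_const (c : ℝ)).sub
      (hm.mul_const (Real.log c))).add (hst.const_mul 3)).sub ((hm.div_const 2).mul h2)
    simpa using this
  · filter_upwards [eventually_two_mul_lt 0 hm, eventually_ge_atTop 1] with n hlt hn1 a
    have hn : (0 : ℝ) < n := by exact_mod_cast hn1
    set M := 2 * m n with hM
    set s := M.sqrt with hs
    have hD : ((n * (n - 1) - M : ℕ) : ℝ) = n ^ 2 * w n := by
      rw [Nat.cast_sub (by omega), Nat.cast_mul, Nat.cast_sub hn1]
      simp only [hw, hx, hM]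
      push_cast
      field_simp
    have hD0 : (0 : ℝ) < ((n * (n - 1) - M : ℕ) : ℝ) := by exact_mod_cast (by omega)
    have hw0 : 0 < w n := by
      rw [hD] at hD0
      exact pos_of_mul_pos_right hD0 (by positivity)
    have hMx : (M : ℝ) = n * x n := by simp only [hx, hM]; push_cast; field_simp
    have hmx : (m n : ℝ) = n * (x n / 2) := by simp only [hx]; field_simp
    have hMy : (M : ℝ) + 1 = n * y n := by simp only [hy]; rw [hMx]; field_simp
    have hy0 : 0 < y n := by
      have : (0 : ℝ) < n * y n := by rw [← hMy]; positivity
      exact pos_of_mul_pos_right this hn.le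
    have hfac : (0 : ℝ) < M.factorial := by exact_mod_cast Nat.factorial_pos _
    have hpos : 0 < M.factorial * Real.exp (n * c) / (c : ℝ) ^ M *
        (((n + 1) ^ (s + 1) * (M + 1) ^ s : ℕ) * Real.exp (-(n * a))) /
        ((n * (n - 1) - M : ℕ) : ℝ) ^ m n := by positivity
    rw [← Real.log_le_iff_le_exp hpos]
    have hl1 := Real.log_nonneg (x := (n : ℝ) + 1) (by linarith)
    have hl2 : Real.log ((M : ℝ) + 1) ≤ 2 * Real.log ((n : ℝ) + 1) := by
      rw [← Nat.cast_two, ← Real.log_pow]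
      refine Real.log_le_log (by positivity) ?_
      have : M + 1 ≤ (n + 1) ^ 2 := by
        have : n * (n - 1) ≤ n * n := Nat.mul_le_mul_left _ (by omega)
        nlinarith
      exact_mod_cast this
    have hlog : Real.log (M.factorial * Real.exp (n * c) / (c : ℝ) ^ M *
        (((n + 1) ^ (s + 1) * (M + 1) ^ s : ℕ) * Real.exp (-(n * a))) /
        ((n * (n - 1) - M : ℕ) : ℝ) ^ m n) = Real.log M.factorial + n * c - M * Real.log c +
        ((s + 1) * Real.log (n + 1) + s * Real.log (M + 1) - n * a) -
        m n * (2 * Real.log n + Real.log (w n)) := by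
      rw [Real.log_div (by positivity) (by positivity), Real.log_mul (by positivity) (by positivity),
        Real.log_div (by positivity) (by positivity), Real.log_mul (by positivity) (by positivity),
        Real.log_mul (by positivity) (by positivity), Real.log_exp, Real.log_exp, Real.log_pow,
        Real.log_pow, hD, Real.log_mul (by positivity) hw0.ne', Real.log_pow]
      push_cast
      rw [Real.log_mul (by positivity) (by positivity), Real.log_pow, Real.log_pow]
      push_cast
      ring
    rw [hlog]
    have h1 := log_factorial_le M
    have h2 : ((M : ℝ) + 1) * Real.log (M + 1) = n * (y n * (Real.log n + Real.log (y n))) := by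
      rw [hMy, Real.log_mul hn.ne' hy0.ne']
      ring
    have h3 : (s : ℝ) * Real.log ((M : ℝ) + 1) ≤ s * (2 * Real.log ((n : ℝ) + 1)) := by gcongr
    have h4 : (n : ℝ) * (3 * (((s : ℝ) + 1) * Real.log ((n : ℝ) + 1) / n)) =
        3 * (((s : ℝ) + 1) * Real.log ((n : ℝ) + 1)) := by field_simp
    have h5 : (n : ℝ) * (Real.log n / n) = Real.log n := by field_simp
    have h6 : (n : ℝ) * (y n * Real.log n) = n * (x n * Real.log n) + Real.log n := by
      simp only [hy]; field_simp
    have h7 : (m n : ℝ) * (2 * Real.log n + Real.log (w n)) =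
        n * (x n * Real.log n) + n * (x n / 2 * Real.log (w n)) := by rw [hmx]; ring
    have h8 : (M : ℝ) * Real.log c = n * (x n * Real.log c) := by rw [hMx]; ring
    have h9 : (n : ℝ) * (y n * (Real.log n + Real.log (y n))) =
        n * (y n * Real.log n) + n * (y n * Real.log (y n)) := by ring
    rw [h2, hMx, h9, h6] at h1
    rw [h7, h8]
    simp only [mul_add, mul_sub, h5] at h4 ⊢
    linarith

end Asymptotics

/-! ### From exponential bounds to limits in `EReal` -/

section Limits

theorem log_ofReal_exp_div {n : ℕ} (hn : 0 < n) (r : ℝ) :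
    ENNReal.log (ENNReal.ofReal (Real.exp (n * r))) / ((n : ℝ) : EReal) = (r : EReal) := by
  have hn' : (n : ℝ) ≠ 0 := by exact_mod_cast hn.ne'
  rw [ENNReal.log_ofReal_of_pos (Real.exp_pos _), Real.log_exp, ← EReal.coe_div]
  congr 1
  field_simp

theorem limsup_log_div_le {f : ℕ → ℝ≥0∞} {R : ℕ → ℝ} {r : ℝ} (hR : Tendsto R atTop (𝓝 r))
    (h : ∀ᶠ n : ℕ in atTop, f n ≤ ENNReal.ofReal (Real.exp (n * R n))) :
    limsup (fun n : ℕ => ENNReal.log (f n) / ((n : ℝ) : EReal)) atTop ≤ (r : EReal) := by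
  have hR' : Tendsto (fun n => (R n : EReal)) atTop (𝓝 (r : EReal)) :=
    (continuous_coe_real_ereal.tendsto r).comp hR
  rw [← hR'.limsup_eq]
  refine limsup_le_limsup ?_
  filter_upwards [h, eventually_gt_atTop 0] with n hn h0
  rw [← log_ofReal_exp_div h0 (R n)]
  exact EReal.div_le_div_right_of_nonneg (EReal.coe_nonneg.2 n.cast_nonneg) (ENNReal.log_monotone hn)

theorem le_liminf_log_div {f : ℕ → ℝ≥0∞} {R : ℕ → ℝ} {r : ℝ} (hR : Tendsto R atTop (𝓝 r))
    (h : ∀ᶠ n : ℕ in atTop, ENNReal.ofReal (Real.exp (n * R n)) ≤ f n) :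
    (r : EReal) ≤ liminf (fun n : ℕ => ENNReal.log (f n) / ((n : ℝ) : EReal)) atTop := by
  have hR' : Tendsto (fun n => (R n : EReal)) atTop (𝓝 (r : EReal)) :=
    (continuous_coe_real_ereal.tendsto r).comp hR
  rw [← hR'.liminf_eq]
  refine liminf_le_liminf ?_
  filter_upwards [h, eventually_gt_atTop 0] with n hn h0
  rw [← log_ofReal_exp_div h0 (R n)]
  exact EReal.div_le_div_right_of_nonneg (EReal.coe_nonneg.2 n.cast_nonneg) (ENNReal.log_monotone hn)

end Limits

/-! ### The lower bound at finitely supported laws -/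

section LowerAsymptotics

open ProbabilityTheory

variable {c : ℝ≥0} {m : ℕ → ℕ}

/-- Occupation numbers that approximate `n • r`, with total `n` and first moment `M`. -/
def occupation (r : ℕ → ℝ) (K M n : ℕ) : ℕ → ℕ
  | 0 => n - (M - ∑ k ∈ Finset.range K, (k + 2) * ⌊n * r (k + 2)⌋₊) -
      ∑ k ∈ Finset.range K, ⌊n * r (k + 2)⌋₊
  | 1 => M - ∑ k ∈ Finset.range K, (k + 2) * ⌊n * r (k + 2)⌋₊
  | k + 2 => ⌊n * r (k + 2)⌋₊

theorem sum_range_add_two (f : ℕ → ℝ) (K : ℕ) :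
    ∑ k ∈ Finset.range (K + 2), f k = ∑ k ∈ Finset.range K, f (k + 2) + f 1 + f 0 := by
  rw [Finset.sum_range_succ', Finset.sum_range_succ']

theorem sum_range_add_two_nat (f : ℕ → ℕ) (K : ℕ) :
    ∑ k ∈ Finset.range (K + 2), f k = ∑ k ∈ Finset.range K, f (k + 2) + f 1 + f 0 := by
  rw [Finset.sum_range_succ', Finset.sum_range_succ']

theorem tendsto_floor_mul_div {x : ℝ} (hx : 0 ≤ x) :
    Tendsto (fun n : ℕ => (⌊n * x⌋₊ : ℝ) / n) atTop (𝓝 x) := by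
  have := (tendsto_nat_floor_mul_div_atTop hx).comp tendsto_natCast_atTop_atTop
  refine this.congr fun n => ?_
  simp [mul_comm]

/-- Occupations at `k ≥ 2` are rounded down; the one at `1` then corrects the first moment and the
one at `0` the total. Since `r 0` and `r 1` are positive, the natural subtractions are eventually
not truncated. -/
theorem occupation_spec {r : ℕ → ℝ} {K : ℕ} (hr : ∀ k, 0 ≤ r k) (h0 : 0 < r 0) (h1 : 0 < r 1)
    (hsum : ∑ k ∈ Finset.range (K + 2), r k = 1)
    (hmean : ∑ k ∈ Finset.range (K + 2), k * r k = c)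
    (hm : Tendsto (fun n : ℕ => 2 * (m n : ℝ) / (n : ℝ)) atTop (𝓝 (c : ℝ))) :
    (∀ᶠ n : ℕ in atTop,
      ∑ k ∈ Finset.range (K + 2), occupation r K (2 * m n) n k = n ∧
      ∑ k ∈ Finset.range (K + 2), k * occupation r K (2 * m n) n k = 2 * m n) ∧
    ∀ k < K + 2, Tendsto (fun n : ℕ => (occupation r K (2 * m n) n k : ℝ) / n) atTop (𝓝 (r k)) := by
  set A : ℕ → ℕ := fun n => ∑ k ∈ Finset.range K, (k + 2) * ⌊n * r (k + 2)⌋₊ with hA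
  set B : ℕ → ℕ := fun n => ∑ k ∈ Finset.range K, ⌊n * r (k + 2)⌋₊ with hB
  have hAt : Tendsto (fun n : ℕ => (A n : ℝ) / n) atTop
      (𝓝 (∑ k ∈ Finset.range K, ((k : ℝ) + 2) * r (k + 2))) := by
    have : (fun n : ℕ => (A n : ℝ) / n) = fun n : ℕ =>
        ∑ k ∈ Finset.range K, ((k : ℝ) + 2) * ((⌊n * r (k + 2)⌋₊ : ℝ) / n) := by
      funext n
      simp only [hA]
      push_cast
      rw [Finset.sum_div]
      exact Finset.sum_congr rfl fun k _ => by ring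
    rw [this]
    exact tendsto_finsetSum _ fun k _ => (tendsto_floor_mul_div (hr _)).const_mul _
  have hBt : Tendsto (fun n : ℕ => (B n : ℝ) / n) atTop
      (𝓝 (∑ k ∈ Finset.range K, r (k + 2))) := by
    have : (fun n : ℕ => (B n : ℝ) / n) = fun n : ℕ =>
        ∑ k ∈ Finset.range K, ((⌊n * r (k + 2)⌋₊ : ℝ) / n) := by
      funext n
      simp only [hB]
      push_cast
      rw [Finset.sum_div]
    rw [this]
    exact tendsto_finsetSum _ fun k _ => tendsto_floor_mul_div (hr _)
  rw [sum_range_add_two] at hsum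
  rw [sum_range_add_two] at hmean
  push_cast at hmean
  have hr1 : (c : ℝ) - ∑ k ∈ Finset.range K, ((k : ℝ) + 2) * r (k + 2) = r 1 := by linarith
  have hr0 : 1 - r 1 - ∑ k ∈ Finset.range K, r (k + 2) = r 0 := by linarith
  have hone : Tendsto (fun n : ℕ => (2 * (m n : ℝ) - A n) / n) atTop (𝓝 (r 1)) := by
    rw [← hr1]
    exact (hm.sub hAt).congr fun n => by ring
  have hzero : Tendsto (fun n : ℕ => (n - (2 * (m n : ℝ) - A n) - B n) / n) atTop (𝓝 (r 0)) := by
    rw [← hr0]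
    refine ((tendsto_const_nhds.sub hone).sub hBt).congr' ?_
    filter_upwards [eventually_gt_atTop 0] with n hn
    have : (n : ℝ) ≠ 0 := by exact_mod_cast hn.ne'
    field_simp
  have hev1 : ∀ᶠ n : ℕ in atTop, A n ≤ 2 * m n := by
    filter_upwards [hone.eventually (Ioi_mem_nhds h1), eventually_gt_atTop 0] with n hn hn0
    have hn0' : (0 : ℝ) < n := by exact_mod_cast hn0
    have h : 0 < 2 * (m n : ℝ) - A n := (div_pos_iff_of_pos_right hn0').1 hn
    have h' : (A n : ℝ) ≤ (2 * m n : ℕ) := by push_cast; linarith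
    exact_mod_cast h'
  have hev0 : ∀ᶠ n : ℕ in atTop, (2 * m n - A n) + B n ≤ n := by
    filter_upwards [hzero.eventually (Ioi_mem_nhds h0), eventually_gt_atTop 0, hev1]
      with n hn hn0 h1
    have hn0' : (0 : ℝ) < n := by exact_mod_cast hn0
    have h : 0 < n - (2 * (m n : ℝ) - A n) - B n := (div_pos_iff_of_pos_right hn0').1 hn
    have h' : (((2 * m n - A n) + B n : ℕ) : ℝ) ≤ n := by
      push_cast [Nat.cast_sub h1]
      linarith
    exact_mod_cast h'
  have e0 : ∀ n, occupation r K (2 * m n) n 0 = n - (2 * m n - A n) - B n := fun n => rfl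
  have e1 : ∀ n, occupation r K (2 * m n) n 1 = 2 * m n - A n := fun n => rfl
  have e2 : ∀ n k, occupation r K (2 * m n) n (k + 2) = ⌊n * r (k + 2)⌋₊ := fun n k => rfl
  refine ⟨?_, ?_⟩
  · filter_upwards [hev0, hev1] with n hn0 hn1
    rw [sum_range_add_two_nat, sum_range_add_two_nat]
    simp only [e0, e1, e2]
    change B n + _ + _ = n ∧ A n + _ + _ = _
    omega
  · rintro (_ | _ | k) hk
    · refine hzero.congr' ?_
      filter_upwards [hev0, hev1] with n hn0 hn1
      rw [e0, Nat.cast_sub (by omega), Nat.cast_sub (by omega), Nat.cast_sub hn1]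
      push_cast
      rfl
    · refine hone.congr' ?_
      filter_upwards [hev1] with n hn1
      rw [e1, Nat.cast_sub hn1]
      push_cast
      rfl
    · simp only [e2]
      exact tendsto_floor_mul_div (hr _)

/-- The variables `z k = (N k + 1) / n` match the upper bound for `log (N k)!` and stay positive
even when `N k = 0`. The last two terms on the left are the costs of a simple start and of the
patch. -/
theorem le_log_lower_term {n K t J : ℕ} (hn : 0 < n) (N : Fin (K + 1) → ℕ)
    (hN : ∑ k, N k = n) (hJ : K + K ^ 2 ≤ J) (hJ0 : 0 < J) (z : Fin (K + 1) → ℝ)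
    (hz : ∀ k, (N k : ℝ) + 1 = n * z k) {x : ℝ} (hx : (2 * (t + J) : ℝ) = n * x) :
    n * (-((K + 1) * (Real.log n / n)) - ∑ k, z k * Real.log (z k) + x * Real.log x - x
      - ∑ k : Fin (K + 1), (N k : ℝ) / n * Real.log (k : ℕ).factorial
      - x * ((K + K ^ 2) / J) - 2 * (J * Real.log (n + 1) / n)) ≤
    Real.log (arrangements N * ((1 - (K + K ^ 2 : ℝ) / (2 * J)) ^ t *
      ((2 * (t + J)).factorial / ∏ k : Fin (K + 1), ((k : ℕ).factorial : ℝ) ^ N k)) /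
      ((n : ℝ) ^ (2 * J) * (n : ℝ) ^ (2 * (t + J)))) := by
  have hn' : (0 : ℝ) < n := by exact_mod_cast hn
  have hJ' : (0 : ℝ) < J := by exact_mod_cast hJ0
  have hL : (K + K ^ 2 : ℝ) / (2 * J) ≤ 1 / 2 := by
    rw [div_le_div_iff₀ (by positivity) (by positivity)]
    have : (K + K ^ 2 : ℝ) ≤ J := by exact_mod_cast hJ
    linarith
  have hL0 : (0 : ℝ) ≤ (K + K ^ 2 : ℝ) / (2 * J) := by positivity
  have hρ : 0 < 1 - (K + K ^ 2 : ℝ) / (2 * J) := by linarith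
  have hfac : ∀ j : ℕ, 0 < (j.factorial : ℝ) := fun j => by exact_mod_cast Nat.factorial_pos _
  have hP : 0 < ∏ k : Fin (K + 1), ((k : ℕ).factorial : ℝ) ^ N k :=
    Finset.prod_pos fun k _ => pow_pos (hfac _) _
  have hQ : 0 < ∏ k : Fin (K + 1), ((N k).factorial : ℝ) := Finset.prod_pos fun k _ => hfac _
  have hz0 : ∀ k, 0 < z k := fun k => by
    have : (0 : ℝ) < n * z k := by rw [← hz]; positivity
    exact pos_of_mul_pos_right this hn'.le
  rw [Real.log_div (mul_pos (arrangements_pos N) (by have := hfac (2 * (t + J)); positivity)).ne'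
      (by positivity),
    Real.log_mul (arrangements_pos N).ne' (by have := hfac (2 * (t + J)); positivity),
    Real.log_mul (by positivity) (by have := hfac (2 * (t + J)); positivity),
    Real.log_mul (by positivity) (by positivity), arrangements, hN,
    Real.log_div (hfac _).ne' hQ.ne', Real.log_div (hfac _).ne' hP.ne',
    Real.log_prod (fun k _ => (hfac _).ne'), Real.log_prod (fun k _ => (pow_pos (hfac _) _).ne')]
  simp only [Real.log_pow]
  have h1 := le_log_factorial n
  have h2 : ∑ k, Real.log ((N k).factorial : ℝ) ≤
      Real.log n * (n + (K + 1)) + n * ∑ k, z k * Real.log (z k) - n := by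
    calc ∑ k, Real.log ((N k).factorial : ℝ)
        ≤ ∑ k, ((N k + 1 : ℝ) * Real.log n + n * (z k * Real.log (z k)) - N k) := by
          refine Finset.sum_le_sum fun k _ => (log_factorial_le _).trans (le_of_eq ?_)
          have : Real.log ((N k : ℝ) + 1) = Real.log n + Real.log (z k) := by
            rw [hz, Real.log_mul hn'.ne' (hz0 k).ne']
          rw [this, mul_add, hz]
          ring
      _ = _ := by
          rw [Finset.sum_sub_distrib, Finset.sum_add_distrib, ← Finset.sum_mul, ← Finset.mul_sum,
            Finset.sum_add_distrib]
          have : ∑ k, (N k : ℝ) = n := by exact_mod_cast hN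
          rw [this]
          simp
          ring
  have h3 : (n : ℝ) * (x * Real.log x) + n * x * Real.log n - n * x ≤
      Real.log ((2 * (t + J)).factorial : ℝ) := by
    refine le_trans (le_of_eq ?_) (le_log_factorial _)
    have hx' : ((2 * (t + J) : ℕ) : ℝ) = n * x := by push_cast; exact hx
    rw [hx']
    have hx0 : 0 < x := by
      have : (0 : ℝ) < n * x := by rw [← hx]; positivity
      exact pos_of_mul_pos_right this hn'.le
    rw [Real.log_mul hn'.ne' hx0.ne']
    ring
  have h4 : -((n : ℝ) * (x * ((K + K ^ 2) / J))) ≤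
      t * Real.log (1 - (K + K ^ 2 : ℝ) / (2 * J)) := by
    have h := neg_two_mul_le_log_one_sub hL0 hL
    have ht : (t : ℝ) ≤ n * x := by rw [← hx]; have : (0 : ℝ) ≤ t := by positivity
                                    linarith
    have h5 : (2 : ℝ) * ((K + K ^ 2 : ℝ) / (2 * J)) = (K + K ^ 2) / J := by field_simp
    rw [h5] at h
    have h6 : (0 : ℝ) ≤ (K + K ^ 2) / J := by positivity
    have h7 : (0 : ℝ) ≤ t := by positivity
    nlinarith [mul_le_mul_of_nonneg_left h h7, mul_le_mul_of_nonneg_right ht h6]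
  have h5 : (n : ℝ) * ∑ k : Fin (K + 1), (N k : ℝ) / n * Real.log (k : ℕ).factorial =
      ∑ k : Fin (K + 1), (N k : ℝ) * Real.log (k : ℕ).factorial := by
    rw [Finset.mul_sum]
    exact Finset.sum_congr rfl fun k _ => by field_simp
  have h6 : (n : ℝ) * (2 * (J * Real.log ((n : ℝ) + 1) / n)) = 2 * (J * Real.log ((n : ℝ) + 1)) := by
    field_simp
  have h7 : (n : ℝ) * ((K + 1) * (Real.log n / n)) = (K + 1) * Real.log n := by field_simp
  have h8 : (J : ℝ) * Real.log n ≤ J * Real.log ((n : ℝ) + 1) := by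
    gcongr
    linarith
  have h9 : (2 * ((t : ℝ) + J)) * Real.log n = n * x * Real.log n := by rw [hx]
  generalize Real.log ((2 * (t + J)).factorial : ℝ) = F at h3 ⊢
  push_cast
  rw [h9]
  simp only [mul_sub, mul_add, mul_neg, h5, h6] at h7 h2 h4 ⊢
  rw [h7]
  linarith

/-- The lower bound at a finitely supported law. -/
theorem le_liminf_of_finite_support (hc : 0 < c)
    (hm : Tendsto (fun n : ℕ => 2 * (m n : ℝ) / (n : ℝ)) atTop (𝓝 (c : ℝ)))
    {r : ℕ → ℝ} {K : ℕ} (hr : ∀ k, 0 ≤ r k) (h0 : 0 < r 0) (h1 : 0 < r 1)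
    (hsum : ∑ k ∈ Finset.range (K + 2), r k = 1)
    (hmean : ∑ k ∈ Finset.range (K + 2), k * r k = c)
    {Γ : Set (ProbabilityMeasure ℕ)} {δ : ℝ} (hδ : 0 < δ)
    (hΓ : ∀ p : ProbabilityMeasure ℕ,
      (∀ k < K + 2, |(p : Measure ℕ).real {k} - r k| < δ) → p ∈ Γ) :
    ((-∑ k ∈ Finset.range (K + 2), r k * Real.log (r k / (poissonMeasure c).real {k}) : ℝ) :
      EReal) ≤ liminf (fun n : ℕ =>
        ENNReal.log (probDegreeDistributionMem n (m n) Γ) / ((n : ℝ) : EReal)) atTop := by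
  have hc' : (0 : ℝ) < c := hc
  obtain ⟨hspec, hlim⟩ := occupation_spec hr h0 h1 hsum hmean hm
  set N : ℕ → ℕ → ℕ := fun n => occupation r K (2 * m n) n with hN
  -- Order `√n` balances two demands: the loss `(K + K ^ 2) / J` per vertex must vanish, and so must
  -- the patching cost `J log n / n` and the histogram shift `J / n`.
  set J : ℕ → ℕ := Nat.sqrt with hJ
  have hinv : Tendsto (fun n : ℕ => 1 / (n : ℝ)) atTop (𝓝 0) := tendsto_one_div_atTop_nhds_zero_nat
  have hJtop : Tendsto J atTop atTop := by
    refine tendsto_atTop_atTop.2 fun b => ⟨b * b, fun n hn => ?_⟩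
    exact Nat.le_sqrt.2 hn
  have hJn : ∀ n : ℕ, (J n : ℝ) ^ 2 ≤ 1 * ((n : ℝ) + 1) := by
    intro n
    have : ((J n * J n : ℕ) : ℝ) ≤ n := by exact_mod_cast Nat.sqrt_le n
    push_cast at this
    nlinarith
  have hJlog := tendsto_mul_log_div (u := fun n => (J n : ℝ)) (fun n => by positivity)
    (Eventually.of_forall hJn)
  have hJdiv : Tendsto (fun n : ℕ => (J n : ℝ) / n) atTop (𝓝 0) := by
    refine squeeze_zero' (Eventually.of_forall fun n => by positivity) ?_ hJlog
    filter_upwards [eventually_ge_atTop 2] with n hn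
    have : (2 : ℝ) ≤ n := by exact_mod_cast hn
    have hl : 1 ≤ Real.log ((n : ℝ) + 1) := by
      rw [Real.le_log_iff_exp_le (by positivity)]
      have := Real.exp_one_lt_d9
      linarith
    gcongr
    exact le_mul_of_one_le_right (by positivity) hl
  set z : ℕ → ℕ → ℝ := fun n k => (N n k : ℝ) / n + 1 / n with hz
  set x : ℕ → ℝ := fun n => 2 * (m n : ℝ) / n with hx
  have hzt : ∀ k < K + 2, Tendsto (fun n => z n k) atTop (𝓝 (r k)) := by
    intro k hk
    have := (hlim k hk).add hinv
    rwa [add_zero] at this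
  set R : ℕ → ℝ := fun n => -(((K + 1 : ℕ) + 1) * (Real.log n / n)) -
    ∑ k : Fin (K + 1 + 1), z n k * Real.log (z n k) + x n * Real.log (x n) - x n
      - ∑ k : Fin (K + 1 + 1), (N n k : ℝ) / n * Real.log (k : ℕ).factorial
      - x n * (((K + 1 : ℕ) + (K + 1 : ℕ) ^ 2) / J n) - 2 * (J n * Real.log (n + 1) / n) with hR
  have hRt : Tendsto R atTop (𝓝 (-∑ k ∈ Finset.range (K + 2),
      r k * Real.log (r k / (poissonMeasure c).real {k}))) := by
    have t1 := (tendsto_log_div.const_mul (((K + 1 : ℕ) : ℝ) + 1)).neg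
    have t2 : Tendsto (fun n => ∑ k : Fin (K + 1 + 1), z n k * Real.log (z n k)) atTop
        (𝓝 (∑ k : Fin (K + 1 + 1), r k * Real.log (r k))) :=
      tendsto_finsetSum _ fun k _ =>
        (Real.continuous_mul_log.tendsto (r k)).comp (hzt k k.2)
    have t3 : Tendsto (fun n => x n * Real.log (x n)) atTop (𝓝 (c * Real.log c)) :=
      (Real.continuous_mul_log.tendsto (c : ℝ)).comp hm
    have t4 : Tendsto (fun n : ℕ => ∑ k : Fin (K + 1 + 1),
        (N n k : ℝ) / n * Real.log (k : ℕ).factorial) atTop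
        (𝓝 (∑ k : Fin (K + 1 + 1), r k * Real.log (k : ℕ).factorial)) :=
      tendsto_finsetSum _ fun k _ => (hlim k k.2).mul_const _
    have t5 : Tendsto (fun n : ℕ => x n * ((((K + 1 : ℕ) : ℝ) + (K + 1 : ℕ) ^ 2) / J n)) atTop
        (𝓝 (c * 0)) :=
      hm.mul (tendsto_const_nhds.div_atTop (tendsto_natCast_atTop_atTop.comp hJtop))
    have := (((((t1.sub t2).add t3).sub hm).sub t4).sub t5).sub (hJlog.const_mul 2)
    convert this using 2
    have hterm : ∀ k ∈ Finset.range (K + 2), r k * Real.log (r k / (poissonMeasure c).real {k}) =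
        r k * Real.log (r k) + c * r k - Real.log c * (k * r k) +
          r k * Real.log k.factorial := by
      intro k _
      rcases (hr k).eq_or_lt with h | h
      · simp [← h]
      · have hk : (0 : ℝ) < k.factorial := by exact_mod_cast Nat.factorial_pos _
        rw [poissonMeasure_real_singleton, Real.log_div h.ne' (by positivity),
          Real.log_div (by positivity) hk.ne', Real.log_mul (by positivity) (by positivity),
          Real.log_exp, Real.log_pow]
        ring
    rw [Finset.sum_congr rfl hterm, Finset.sum_add_distrib, Finset.sum_sub_distrib,
      Finset.sum_add_distrib, ← Finset.mul_sum, ← Finset.mul_sum, hsum, hmean,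
      Fin.sum_univ_eq_sum_range (fun k => r k * Real.log (r k)),
      Fin.sum_univ_eq_sum_range (fun k => r k * Real.log (k.factorial : ℝ))]
    ring
  refine le_liminf_log_div hRt ?_
  have hJle : ∀ᶠ n : ℕ in atTop, J n ≤ m n := by
    filter_upwards [(hm.sub (hJdiv.const_mul 2)).eventually
      (Ioi_mem_nhds (by simpa using hc' : (0 : ℝ) < c - 2 * 0)), eventually_gt_atTop 0] with n hn hn0
    have hn0' : (0 : ℝ) < n := by exact_mod_cast hn0
    have h : 0 < 2 * (m n : ℝ) / n - 2 * (J n / n) := hn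
    have h2 : 2 * (m n : ℝ) / n - 2 * (J n / n) = 2 * (m n - J n) / n := by ring
    rw [h2] at h
    have h3 := (div_pos_iff_of_pos_right hn0').1 h
    have : (J n : ℝ) ≤ m n := by linarith
    exact_mod_cast this
  have hclose : ∀ᶠ n : ℕ in atTop, ∀ k : Fin (K + 1 + 1),
      |(N n k : ℝ) / n - r k| + 4 * (J n / n) < δ := by
    rw [eventually_all]
    intro k
    have h : Tendsto (fun n : ℕ => |(N n k : ℝ) / n - r k| + 4 * (J n / n)) atTop
        (𝓝 (|r k - r k| + 4 * 0)) :=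
      (((hlim k k.2).sub_const _).abs).add (hJdiv.const_mul 4)
    refine h.eventually (Iio_mem_nhds ?_)
    simpa using hδ
  filter_upwards [hspec, hJle, hclose, eventually_two_mul_lt 0 hm, eventually_gt_atTop 0,
    hJtop.eventually_ge_atTop (K + 1 + (K + 1) ^ 2)] with n hn hJm hcl hlt hn0 hJK
  have : NeZero n := ⟨hn0.ne'⟩
  have hn0' : (0 : ℝ) < n := by exact_mod_cast hn0
  obtain ⟨t, ht⟩ : ∃ t, m n = t + J n := ⟨m n - J n, by omega⟩
  have hN1 : ∑ k : Fin (K + 1 + 1), N n k = n := by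
    rw [Fin.sum_univ_eq_sum_range (N n)]
    exact hn.1
  have hN2 : ∑ k : Fin (K + 1 + 1), (k : ℕ) * N n k = 2 * (t + J n) := by
    rw [Fin.sum_univ_eq_sum_range (fun k => k * N n k), ← ht]
    exact hn.2
  have hJ0 : 0 < J n := by omega
  have hlow := le_probDegreeDistributionMem (K := K + 1) (t := t) (J := J n)
    (fun k => N n k) hN1 hN2 (by omega) (by rw [← ht]; omega) (Γ := Γ) (fun p hp => hΓ p ?_)
  · rw [ht]
    refine le_trans (ENNReal.ofReal_le_ofReal ?_) hlow
    have hlog := le_log_lower_term hn0 (fun k : Fin (K + 1 + 1) => N n k) hN1 hJK hJ0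
      (fun k => z n k) (fun k => by simp only [hz]; field_simp) (x := x n) (t := t)
      (by simp only [hx, ht]; push_cast; field_simp)
    refine (Real.le_log_iff_exp_le ?_).1 hlog
    have hL : (((K + 1 : ℕ) : ℝ) + ((K + 1 : ℕ) : ℝ) ^ 2) / (2 * J n) < 1 := by
      rw [div_lt_one (by positivity)]
      have : (((K + 1 : ℕ) : ℝ) + ((K + 1 : ℕ) : ℝ) ^ 2) ≤ J n := by exact_mod_cast hJK
      have : (0 : ℝ) < J n := by exact_mod_cast hJ0
      linarith
    have hρ : 0 < 1 - (((K + 1 : ℕ) : ℝ) + ((K + 1 : ℕ) : ℝ) ^ 2) / (2 * J n) := by linarith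
    have hfac : ∀ j : ℕ, 0 < (j.factorial : ℝ) := fun j => by exact_mod_cast Nat.factorial_pos _
    have hP : 0 < ∏ k : Fin (K + 1 + 1), ((k : ℕ).factorial : ℝ) ^ N n k :=
      Finset.prod_pos fun k _ => pow_pos (hfac _) _
    have := hfac (2 * (t + J n))
    have := arrangements_pos fun k : Fin (K + 1 + 1) => N n k
    positivity
  · intro k hk
    have h1 := hp ⟨k, hk⟩
    have h2 := hcl ⟨k, hk⟩
    simp only at h1 h2
    have h3 := abs_sub_le ((p : Measure ℕ).real {k}) ((N n k : ℝ) / n) (r k)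
    have h4 : 4 * (J n : ℝ) / n = 4 * (J n / n) := by ring
    linarith

end LowerAsymptotics

/-! ### The lower bound at general laws, by truncation and mixing -/

section LowerBound

open InformationTheory ProbabilityTheory

variable {c : ℝ≥0} {m : ℕ → ℕ}

theorem hasSum_of_tsum_ofReal {g : ℕ → ℝ} (hg : ∀ k, 0 ≤ g k) {A : ℝ≥0∞}
    (h : ∑' k, ENNReal.ofReal (g k) = A) (hA : A ≠ ∞) : HasSum g A.toReal := by
  have hs : Summable g := by
    have := ENNReal.summable_toReal (h ▸ hA)
    exact this.congr fun k => ENNReal.toReal_ofReal (hg k)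
  rw [← ENNReal.ofReal_tsum_of_nonneg hg hs] at h
  rw [← h, ENNReal.toReal_ofReal (tsum_nonneg hg)]
  exact hs.hasSum

theorem hasSum_real_singleton (p : Measure ℕ) [IsProbabilityMeasure p] :
    HasSum (fun k => p.real {k}) 1 := by
  have h : ∑' k, ENNReal.ofReal (p.real {k}) = 1 := by
    have : p Set.univ = 1 := measure_univ
    rw [← lintegral_one, lintegral_countable'] at this
    simpa using this
  simpa using hasSum_of_tsum_ofReal (fun k => measureReal_nonneg) h (by simp)

theorem hasSum_mul_real_singleton {p : ProbabilityMeasure ℕ} (h : firstMoment p = c) :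
    HasSum (fun k : ℕ => k * (p : Measure ℕ).real {k}) c := by
  have h' : ∑' k : ℕ, ENNReal.ofReal (k * (p : Measure ℕ).real {k}) = c := by
    rw [← h, firstMoment]
    refine tsum_congr fun k => ?_
    rw [ENNReal.ofReal_mul (by positivity), ENNReal.ofReal_natCast, ofReal_measureReal]
  simpa using hasSum_of_tsum_ofReal (fun k => by positivity) h' (by simp)

theorem tendsto_sum_range_shift {f : ℕ → ℝ} {a : ℝ} (h : HasSum f a) :
    Tendsto (fun K => ∑ k ∈ Finset.range K, f (k + 2)) atTop (𝓝 (a - f 1 - f 0)) := by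
  have := h.tendsto_sum_nat.comp (tendsto_add_atTop_nat 2)
  have h2 := (this.sub_const (f 0)).sub_const (f 1)
  rw [sub_right_comm a (f 0)] at h2
  refine h2.congr fun K => ?_
  simp only [Function.comp_apply]
  rw [sum_range_add_two]
  ring

/-- This splits the signed entropy summand into three summable families, so that partial sums of the
entropy converge. -/
theorem mul_log_div_eq {q x : ℝ} (hq : 0 < q) :
    x * Real.log (x / q) = q * klFun (x / q) - q + x := by
  rw [klFun_apply]
  field_simp
  ring

/-- The lower bound at a law with positive mass at `0` and `1`. -/
theorem neg_klDiv_le_liminf_of_pos (hc : 0 < c)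
    (hm : Tendsto (fun n : ℕ => 2 * (m n : ℝ) / (n : ℝ)) atTop (𝓝 (c : ℝ)))
    {Γ : Set (ProbabilityMeasure ℕ)} {p : ProbabilityMeasure ℕ} (hp : p ∈ interior Γ)
    (hmean : firstMoment p = c) (hfin : klDiv (p : Measure ℕ) (poissonMeasure c) ≠ ∞)
    (h0 : 0 < (p : Measure ℕ).real {0}) (h1 : 0 < (p : Measure ℕ).real {1}) :
    -(klDiv (p : Measure ℕ) (poissonMeasure c) : EReal) ≤ liminf (fun n : ℕ =>
        ENNReal.log (probDegreeDistributionMem n (m n) Γ) / ((n : ℝ) : EReal)) atTop := by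
  set P : ℕ → ℝ := fun k => (p : Measure ℕ).real {k} with hP
  set q : ℕ → ℝ := fun k => (poissonMeasure c).real {k} with hq
  have hq0 : ∀ k, 0 < q k := fun k => poissonMeasure_real_singleton_pos k hc
  set g : ℕ → ℝ := fun k => q k * klFun (P k / q k) with hg
  have hgsum : HasSum g (klDiv (p : Measure ℕ) (poissonMeasure c)).toReal :=
    hasSum_of_tsum_ofReal (fun k => klFun_term_nonneg _ _) (klDiv_poissonMeasure hc _).symm hfin
  have hPsum : HasSum P 1 := hasSum_real_singleton _
  have hqsum : HasSum q 1 := hasSum_real_singleton _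
  have hMsum : HasSum (fun k : ℕ => k * P k) c := hasSum_mul_real_singleton hmean
  -- The law is cut off after `K + 1`. The mass `r1` at `1` restores the mean `c` and `r0` at `0`
  -- restores the total; both converge to the original masses, hence are eventually positive.
  set r1 : ℕ → ℝ := fun K => c - ∑ k ∈ Finset.range K, ((k + 2 : ℕ) : ℝ) * P (k + 2) with hr1
  set r0 : ℕ → ℝ := fun K => 1 - r1 K - ∑ k ∈ Finset.range K, P (k + 2) with hr0
  have hr1t : Tendsto r1 atTop (𝓝 (P 1)) := by
    have := (tendsto_sum_range_shift hMsum).const_sub (c : ℝ)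
    convert this using 2
    simp
  have hr0t : Tendsto r0 atTop (𝓝 (P 0)) := by
    have := (hr1t.const_sub 1).sub (tendsto_sum_range_shift hPsum)
    convert this using 2
    ring
  let r : ℕ → ℕ → ℝ := fun K k => match k with
    | 0 => r0 K
    | 1 => r1 K
    | k + 2 => P (k + 2)
  have hr_0 : ∀ K, r K 0 = r0 K := fun _ => rfl
  have hr_1 : ∀ K, r K 1 = r1 K := fun _ => rfl
  have hr_2 : ∀ K k, r K (k + 2) = P (k + 2) := fun _ _ => rfl
  have hS : Tendsto (fun K => ∑ k ∈ Finset.range (K + 2),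
      r K k * Real.log (r K k / (poissonMeasure c).real {k})) atTop
      (𝓝 (klDiv (p : Measure ℕ) (poissonMeasure c)).toReal) := by
    have hcont : ∀ k, Continuous fun x : ℝ => q k * klFun (x / q k) - q k + x := fun k =>
      ((continuous_const.mul (continuous_klFun.comp (continuous_id.div_const _))).sub
        continuous_const).add continuous_id
    have t := (((tendsto_sum_range_shift hgsum).sub (tendsto_sum_range_shift hqsum)).add
      (tendsto_sum_range_shift hPsum)).add
        (((hcont 1).tendsto (P 1)).comp hr1t) |>.add (((hcont 0).tendsto (P 0)).comp hr0t)
    convert t using 2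
    · rename_i K
      rw [sum_range_add_two, hr_0, hr_1]
      simp only [hr_2, Function.comp_apply]
      rw [mul_log_div_eq (hq0 0), mul_log_div_eq (hq0 1),
        Finset.sum_congr rfl fun k _ => mul_log_div_eq (hq0 (k + 2)), Finset.sum_add_distrib,
        Finset.sum_sub_distrib]
    · simp only [hg]
      ring
  obtain ⟨K₀, δ, hδ, hU⟩ := exists_coordinates_of_mem_nhds (mem_interior_iff_mem_nhds.1 hp)
  have hlim : Tendsto (fun K => ((-∑ k ∈ Finset.range (K + 2),
      r K k * Real.log (r K k / (poissonMeasure c).real {k}) : ℝ) : EReal)) atTop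
      (𝓝 (-(klDiv (p : Measure ℕ) (poissonMeasure c) : EReal))) := by
    have : -(klDiv (p : Measure ℕ) (poissonMeasure c) : EReal) =
        ((-(klDiv (p : Measure ℕ) (poissonMeasure c)).toReal : ℝ) : EReal) := by
      rw [EReal.coe_neg, EReal.coe_ennreal_toReal hfin]
    rw [this]
    exact (continuous_coe_real_ereal.tendsto _).comp hS.neg
  refine le_of_tendsto hlim ?_
  filter_upwards [hr1t.eventually (Ioi_mem_nhds h1), hr0t.eventually (Ioi_mem_nhds h0),
    hr1t.eventually (Metric.ball_mem_nhds _ (half_pos hδ)),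
    hr0t.eventually (Metric.ball_mem_nhds _ (half_pos hδ)), eventually_ge_atTop K₀]
    with K hK1 hK0 hd1 hd0 hKK
  refine le_liminf_of_finite_support hc hm (r := r K) (K := K) (δ := δ / 2) ?_ hK0 hK1 ?_ ?_
    (half_pos hδ) ?_
  · rintro (_ | _ | k)
    · exact (show (0 : ℝ) < r0 K from hK0).le
    · exact (show (0 : ℝ) < r1 K from hK1).le
    · exact measureReal_nonneg
  · rw [sum_range_add_two]
    simp only [hr_0, hr_1, hr_2, hr0]
    ring
  · rw [sum_range_add_two]
    simp only [hr_0, hr_1, hr_2, hr1]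
    simp
  · intro ν hν
    refine hU ν fun k hk => ?_
    have h2 := hν k (by omega)
    rw [Real.dist_eq] at hd0 hd1
    have h3 : |r K k - P k| < δ / 2 := by
      rcases k with _ | _ | k
      · exact hd0
      · exact hd1
      · rw [hr_2 K k, sub_self, abs_zero]
        exact half_pos hδ
    have h4 := abs_sub_le ((ν : Measure ℕ).real {k}) (r K k) (P k)
    simp only [hP] at h4 h3
    linarith

/-- The mixture of a law with the Poisson law. -/
def mixPoisson (c : ℝ≥0) (p : ProbabilityMeasure ℕ) (η : ℝ≥0) (hη : η ≤ 1) :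
    ProbabilityMeasure ℕ :=
  ⟨(1 - η) • (p : Measure ℕ) + η • poissonMeasure c, ⟨by
    simp only [Measure.coe_add, Pi.add_apply, Measure.smul_apply, measure_univ]
    rw [← add_smul, tsub_add_cancel_of_le hη]
    simp⟩⟩

theorem mixPoisson_singleton (c : ℝ≥0) (p : ProbabilityMeasure ℕ) {η : ℝ≥0} (hη : η ≤ 1) (k : ℕ) :
    (mixPoisson c p η hη : Measure ℕ) {k} =
      ((1 - η : ℝ≥0) : ℝ≥0∞) * (p : Measure ℕ) {k} + η * poissonMeasure c {k} := rfl

theorem mixPoisson_real_singleton (c : ℝ≥0) (p : ProbabilityMeasure ℕ) {η : ℝ≥0} (hη : η ≤ 1)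
    (k : ℕ) : (mixPoisson c p η hη : Measure ℕ).real {k} =
      (1 - η) * (p : Measure ℕ).real {k} + η * (poissonMeasure c).real {k} := by
  rw [measureReal_def, mixPoisson_singleton, ENNReal.toReal_add
    (ENNReal.mul_ne_top ENNReal.coe_ne_top (measure_ne_top _ _))
    (ENNReal.mul_ne_top ENNReal.coe_ne_top (measure_ne_top _ _)), ENNReal.toReal_mul,
    ENNReal.toReal_mul, ENNReal.coe_toReal, ENNReal.coe_toReal, NNReal.coe_sub hη]
  rfl

theorem tsum_mul_poissonMeasure (c : ℝ≥0) :
    ∑' k : ℕ, (k : ℝ≥0∞) * poissonMeasure c {k} = c := by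
  rw [tsum_eq_zero_add' ENNReal.summable]
  have h : ∀ k : ℕ, ((k + 1 : ℕ) : ℝ≥0∞) * poissonMeasure c {k + 1} = c * poissonMeasure c {k} := by
    intro k
    rw [poissonMeasure_singleton, poissonMeasure_singleton, ← ENNReal.ofReal_natCast,
      ← ENNReal.ofReal_mul (by positivity), ← ENNReal.ofReal_coe_nnreal (p := c),
      ← ENNReal.ofReal_mul (by positivity)]
    congr 1
    rw [Nat.factorial_succ]
    push_cast
    have : (0 : ℝ) < k.factorial := by exact_mod_cast Nat.factorial_pos _
    field_simp
    ring
  simp_rw [h]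
  rw [ENNReal.tsum_mul_left]
  have : ∑' k, poissonMeasure c {k} = 1 := by
    have : poissonMeasure c Set.univ = 1 := measure_univ
    rw [← lintegral_one, lintegral_countable'] at this
    simpa using this
  simp [this]

theorem firstMoment_mixPoisson {p : ProbabilityMeasure ℕ} (h : firstMoment p = c) {η : ℝ≥0}
    (hη : η ≤ 1) : firstMoment (mixPoisson c p η hη) = c := by
  unfold firstMoment at h ⊢
  simp_rw [mixPoisson_singleton, mul_add, mul_left_comm _ ((1 - η : ℝ≥0) : ℝ≥0∞),
    mul_left_comm _ (η : ℝ≥0∞)]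
  rw [ENNReal.tsum_add, ENNReal.tsum_mul_left, ENNReal.tsum_mul_left, h, tsum_mul_poissonMeasure,
    ← add_mul, ← ENNReal.coe_add, tsub_add_cancel_of_le hη]
  simp

/-- Termwise convexity of `klFun`, which vanishes at `1`, the density of the Poisson law with
respect to itself. -/
theorem klDiv_mixPoisson_le (hc : 0 < c) (p : ProbabilityMeasure ℕ) {η : ℝ≥0} (hη : η ≤ 1) :
    klDiv (mixPoisson c p η hη : Measure ℕ) (poissonMeasure c) ≤
      klDiv (p : Measure ℕ) (poissonMeasure c) := by
  rw [klDiv_poissonMeasure hc, klDiv_poissonMeasure hc]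
  refine ENNReal.tsum_le_tsum fun k => ENNReal.ofReal_le_ofReal ?_
  have hq := poissonMeasure_real_singleton_pos (r := c) k hc
  rw [mixPoisson_real_singleton]
  have hη' : (η : ℝ) ≤ 1 := by exact_mod_cast hη
  have hx : (0 : ℝ) ≤ (p : Measure ℕ).real {k} / (poissonMeasure c).real {k} := by positivity
  have h := convexOn_klFun.2 (Set.mem_Ici.2 hx) (Set.mem_Ici.2 zero_le_one)
    (sub_nonneg.2 hη') η.2 (by ring : (1 - (η : ℝ)) + η = 1)
  simp only [smul_eq_mul, klFun_one, mul_zero, add_zero, mul_one] at h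
  have e : ((1 - (η : ℝ)) * (p : Measure ℕ).real {k} + η * (poissonMeasure c).real {k}) /
      (poissonMeasure c).real {k} =
      (1 - η) * ((p : Measure ℕ).real {k} / (poissonMeasure c).real {k}) + η := by
    field_simp
  rw [e]
  refine mul_le_mul_of_nonneg_left (h.trans ?_) hq.le
  have := klFun_nonneg hx
  have hη0 : (0 : ℝ) ≤ η := η.2
  nlinarith

/-- Mixing with a little Poisson law gives positive mass at `0` and `1`, keeps the mean and does not
increase the entropy. One mixture inside the interior of `Γ` therefore suffices. -/
theorem neg_rate_le_liminf (hc : 0 < c)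
    (hm : Tendsto (fun n : ℕ => 2 * (m n : ℝ) / (n : ℝ)) atTop (𝓝 (c : ℝ)))
    {Γ : Set (ProbabilityMeasure ℕ)} {p : ProbabilityMeasure ℕ} (hp : p ∈ interior Γ) :
    -(rate c p : EReal) ≤ liminf (fun n : ℕ =>
        ENNReal.log (probDegreeDistributionMem n (m n) Γ) / ((n : ℝ) : EReal)) atTop := by
  by_cases hmean : firstMoment p = c
  swap
  · simp [rate_of_ne hmean]
  rw [rate_of_eq hmean]
  by_cases hfin : klDiv (p : Measure ℕ) (poissonMeasure c) = ∞
  · simp [hfin]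
  set η : ℕ → ℝ≥0 := fun j => 1 / ((j : ℝ≥0) + 1) with hηdef
  have hη : ∀ j, η j ≤ 1 := fun j => by
    simp only [hηdef]
    exact div_le_one_of_le₀ (by simp) (by positivity)
  have hη0 : ∀ j, 0 < η j := fun j => by simp only [hηdef]; positivity
  have hηt : Tendsto (fun j => (η j : ℝ)) atTop (𝓝 0) := by
    have := tendsto_one_div_add_atTop_nhds_zero_nat (𝕜 := ℝ)
    refine this.congr fun j => ?_
    simp [hηdef]
  have ht : Tendsto (fun j => mixPoisson c p (η j) (hη j)) atTop (𝓝 p) := by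
    refine tendsto_of_tendsto_singleton fun k => ?_
    simp_rw [mixPoisson_real_singleton]
    have := ((hηt.const_sub 1).mul_const ((p : Measure ℕ).real {k})).add
      (hηt.mul_const ((poissonMeasure c).real {k}))
    simpa using this
  obtain ⟨j, hj⟩ := (ht.eventually (isOpen_interior.mem_nhds hp)).exists
  have hpos : ∀ k, 0 < (mixPoisson c p (η j) (hη j) : Measure ℕ).real {k} := by
    intro k
    rw [mixPoisson_real_singleton]
    have hq := poissonMeasure_real_singleton_pos (r := c) k hc
    have h1 : (η j : ℝ) ≤ 1 := by exact_mod_cast hη j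
    have h2 : (0 : ℝ) < η j := by exact_mod_cast hη0 j
    have h3 : (0 : ℝ) ≤ (p : Measure ℕ).real {k} := measureReal_nonneg
    have h4 : 0 ≤ (1 - (η j : ℝ)) * (p : Measure ℕ).real {k} :=
      mul_nonneg (sub_nonneg.2 h1) h3
    positivity
  have hle := klDiv_mixPoisson_le hc p (hη j)
  refine le_trans ?_ (neg_klDiv_le_liminf_of_pos hc hm hj (firstMoment_mixPoisson hmean (hη j))
    (ne_top_of_le_ne_top hfin hle) (hpos 0) (hpos 1))
  exact EReal.neg_le_neg_iff.2 (EReal.coe_ennreal_le_coe_ennreal_iff.2 hle)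

end LowerBound

/-! ### The upper bound for `c > 0` -/

section UpperBound

open InformationTheory ProbabilityTheory

variable {c : ℝ≥0} {m : ℕ → ℕ}

theorem limsup_le_zero (m : ℕ → ℕ) (Γ : Set (ProbabilityMeasure ℕ)) :
    limsup (fun n : ℕ =>
      ENNReal.log (probDegreeDistributionMem n (m n) Γ) / ((n : ℝ) : EReal)) atTop ≤ 0 := by
  have := limsup_log_div_le (f := fun n => probDegreeDistributionMem n (m n) Γ)
    (R := fun _ => 0) (r := 0) tendsto_const_nhds
    (Eventually.of_forall fun n => by simpa using probDegreeDistributionMem_le_one n (m n) Γ)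
  simpa using this

theorem tendsto_inv_mul_natCast
    (hm : Tendsto (fun n : ℕ => 2 * (m n : ℝ) / (n : ℝ)) atTop (𝓝 (c : ℝ))) :
    Tendsto (fun n : ℕ => (n : ℝ≥0∞)⁻¹ * (2 * m n : ℕ)) atTop (𝓝 (c : ℝ≥0∞)) := by
  have h := ENNReal.tendsto_ofReal hm
  rw [ENNReal.ofReal_coe_nnreal] at h
  refine h.congr' ?_
  filter_upwards [eventually_gt_atTop 0] with n hn
  have hn' : (0 : ℝ) < n := by exact_mod_cast hn
  rw [ENNReal.ofReal_div_of_pos hn', ENNReal.ofReal_natCast, ENNReal.div_eq_inv_mul,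
    ← ENNReal.ofReal_natCast (2 * m n)]
  push_cast
  rfl

/-- The means of laws in `closure Γ` with entropy at most `a` form a compact set, which misses `c`
because the rate exceeds `a` there. It then misses `2m/n` for large `n`, so every law in `Γ` of mean
`2m/n` has entropy above `a`. -/
theorem limsup_le_neg_of_lt (hc : 0 < c)
    (hm : Tendsto (fun n : ℕ => 2 * (m n : ℝ) / (n : ℝ)) atTop (𝓝 (c : ℝ)))
    {Γ : Set (ProbabilityMeasure ℕ)} {a : ℝ≥0} (ha : ∀ p ∈ closure Γ, (a : ℝ≥0∞) < rate c p) :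
    limsup (fun n : ℕ =>
      ENNReal.log (probDegreeDistributionMem n (m n) Γ) / ((n : ℝ) : EReal)) atTop ≤
        ((-a : ℝ) : EReal) := by
  have hcomp : IsCompact (firstMoment '' (closure Γ ∩ entropySublevel c a)) := by
    refine IsCompact.image_of_continuousOn ?_
      ((continuousOn_firstMoment hc a).mono Set.inter_subset_right)
    exact (isCompact_entropySublevel hc a).inter_left isClosed_closure
  have hnot : (c : ℝ≥0∞) ∉ firstMoment '' (closure Γ ∩ entropySublevel c a) := by
    rintro ⟨p, ⟨hp, hpa⟩, hpc⟩
    have := ha p hp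
    rw [rate_of_eq hpc] at this
    exact absurd hpa (not_le.2 this)
  obtain ⟨R, hR, hRle⟩ := exists_upper_rate hc hm
  have hRa : Tendsto (fun n => R n - a) atTop (𝓝 (-a : ℝ)) := by
    simpa using hR.sub_const (a : ℝ)
  refine limsup_log_div_le hRa ?_
  filter_upwards [(tendsto_inv_mul_natCast hm).eventually
    (hcomp.isClosed.isOpen_compl.mem_nhds hnot), hRle, eventually_gt_atTop 0,
    eventually_two_mul_lt 0 hm] with n hn hle hn0 hlt
  have : NeZero n := ⟨hn0.ne'⟩
  refine (probDegreeDistributionMem_le hc (a := a) (by omega) fun p hp hpm => ?_).trans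
    (ENNReal.ofReal_le_ofReal (hle a))
  by_contra! hcon
  exact hn ⟨p, ⟨subset_closure hp, hcon.le⟩, hpm⟩

theorem limsup_le_neg_iInf (hc : 0 < c)
    (hm : Tendsto (fun n : ℕ => 2 * (m n : ℝ) / (n : ℝ)) atTop (𝓝 (c : ℝ)))
    (Γ : Set (ProbabilityMeasure ℕ)) :
    limsup (fun n : ℕ =>
      ENNReal.log (probDegreeDistributionMem n (m n) Γ) / ((n : ℝ) : EReal)) atTop ≤
        -(⨅ p ∈ closure Γ, (rate c p : EReal)) := by
  rw [EReal.le_neg]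
  refine EReal.ge_of_forall_gt_iff_ge.1 fun b hb => ?_
  rw [EReal.le_neg]
  rcases le_or_gt b 0 with hb0 | hb0
  -- Levels `b ≤ 0` need only that probabilities are at most one.
  · refine (limsup_le_zero m Γ).trans ?_
    rw [← EReal.coe_neg]
    exact_mod_cast neg_nonneg.2 hb0
  · have hlt : ∀ p ∈ closure Γ, ((b.toNNReal : ℝ≥0) : ℝ≥0∞) < rate c p := by
      intro p hp
      have h1 : (b : EReal) < (rate c p : EReal) := lt_of_lt_of_le hb (iInf₂_le p hp)
      have h2 : (b : EReal) = (((b.toNNReal : ℝ≥0) : ℝ≥0∞) : EReal) := by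
        rw [EReal.coe_nnreal_eq_coe_real, Real.coe_toNNReal b hb0.le]
      rw [h2] at h1
      exact EReal.coe_ennreal_lt_coe_ennreal_iff.1 h1
    have := limsup_le_neg_of_lt hc hm hlt
    rwa [Real.coe_toNNReal b hb0.le, EReal.coe_neg] at this

end UpperBound

/-! ### The degenerate case `c = 0` -/

section ZeroMean

variable {m : ℕ → ℕ}

/-- At most `2m = o(n)` vertices have positive degree, so convergence to `δ_0` is deterministic and
uniform over degree sequences. Probabilities of neighbourhoods of `δ_0` are eventually one, and
those of sets whose closure misses it are eventually zero. -/
theorem eventually_empirical_mem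
    (hm : Tendsto (fun n : ℕ => 2 * (m n : ℝ) / (n : ℝ)) atTop (𝓝 0))
    {U : Set (ProbabilityMeasure ℕ)} (hU : U ∈ 𝓝 diracZero) :
    ∀ᶠ n : ℕ in atTop, ∀ d : Fin n → ℕ, ∑ i, d i = 2 * m n →
      ∀ p : ProbabilityMeasure ℕ, (p : Measure ℕ) = empirical d → p ∈ U := by
  obtain ⟨K, δ, hδ, h⟩ := exists_coordinates_of_mem_nhds hU
  filter_upwards [hm.eventually (Iio_mem_nhds hδ), eventually_gt_atTop 0] with n hn hn0 d hd p hp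
  have hn0' : (0 : ℝ) < n := by exact_mod_cast hn0
  refine h p fun k _ => lt_of_le_of_lt ?_ hn
  rw [hp, empirical_real_singleton]
  have hcard : (Finset.univ.filter fun i => d i ≠ 0).card ≤ 2 * m n := by
    rw [← hd, Finset.card_eq_sum_ones]
    refine (Finset.sum_le_sum fun i hi => ?_).trans
      (Finset.sum_le_sum_of_subset (Finset.subset_univ _))
    exact Nat.one_le_iff_ne_zero.2 (Finset.mem_filter.1 hi).2
  have hcard' : ((Finset.univ.filter fun i => d i ≠ 0).card : ℝ) ≤ 2 * m n := by exact_mod_cast hcard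
  rcases Nat.eq_zero_or_pos k with rfl | hk
  · have h1 := Finset.card_filter_add_card_filter_not (s := (Finset.univ : Finset (Fin n)))
      (fun i => d i = 0)
    rw [Finset.card_univ, Fintype.card_fin] at h1
    have h2 : (histogram d 0 : ℝ) + (Finset.univ.filter fun i => d i ≠ 0).card = n := by
      exact_mod_cast h1
    have h3 : (diracZero : Measure ℕ).real {0} = 1 := by simp [diracZero, measureReal_def]
    rw [h3, div_sub_one hn0'.ne', abs_div, abs_of_pos hn0']
    gcongr
    rw [abs_le]
    constructor <;> linarith [Nat.cast_nonneg (α := ℝ) (Finset.univ.filter fun i => d i ≠ 0).card]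
  · have h3 : (diracZero : Measure ℕ).real {k} = 0 := by
      simp [diracZero, measureReal_def, hk.ne]
    rw [h3, sub_zero, abs_of_nonneg (by positivity)]
    gcongr
    refine le_trans ?_ hcard'
    unfold histogram
    gcongr with i
    omega

theorem le_liminf_of_zero
    (hm : Tendsto (fun n : ℕ => 2 * (m n : ℝ) / (n : ℝ)) atTop (𝓝 0))
    {Γ : Set (ProbabilityMeasure ℕ)} (hΓ : Γ ∈ 𝓝 diracZero) :
    0 ≤ liminf (fun n : ℕ =>
      ENNReal.log (probDegreeDistributionMem n (m n) Γ) / ((n : ℝ) : EReal)) atTop := by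
  have := le_liminf_log_div (f := fun n => probDegreeDistributionMem n (m n) Γ)
    (R := fun _ => 0) (r := 0) tendsto_const_nhds ?_
  · simpa using this
  filter_upwards [eventually_empirical_mem hm hΓ, eventually_two_mul_lt (c := 0) 0 (by simpa using hm),
    eventually_gt_atTop 0] with n hn hlt hn0
  have : NeZero n := ⟨hn0.ne'⟩
  have hpos := pow_le_simpleSeqCount_true n (m n)
  have h0 : 0 < (n * (n - 1) - 2 * m n) ^ m n := pow_pos (by omega) _
  rw [mul_zero, Real.exp_zero, ENNReal.ofReal_one, probDegreeDistributionMem_eq]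
  rw [ENNReal.le_div_iff_mul_le (Or.inl (by exact_mod_cast (h0.trans_le hpos).ne'))
    (Or.inl (ENNReal.natCast_ne_top _)), one_mul]
  norm_cast
  refine Set.ncard_le_ncard (fun s hs => ⟨hs.1, ?_⟩) (Set.toFinite _)
  exact ⟨⟨empirical (endpointCount s), inferInstance⟩, hn _ (sum_endpointCount s) _ rfl, rfl⟩

theorem limsup_eq_bot_of_zero
    (hm : Tendsto (fun n : ℕ => 2 * (m n : ℝ) / (n : ℝ)) atTop (𝓝 0))
    {Γ : Set (ProbabilityMeasure ℕ)} (hΓ : diracZero ∉ closure Γ) :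
    limsup (fun n : ℕ =>
      ENNReal.log (probDegreeDistributionMem n (m n) Γ) / ((n : ℝ) : EReal)) atTop = ⊥ := by
  have hev : (fun n : ℕ =>
      ENNReal.log (probDegreeDistributionMem n (m n) Γ) / ((n : ℝ) : EReal)) =ᶠ[atTop]
      fun _ => ⊥ := by
    filter_upwards [eventually_empirical_mem hm (isClosed_closure.isOpen_compl.mem_nhds hΓ),
      eventually_gt_atTop 0] with n hn hn0
    have h0 : simpleSeqCount n (m n) (fun d => ∃ p ∈ Γ, (p : Measure ℕ) = empirical d) = 0 := by
      unfold simpleSeqCount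
      rw [Set.ncard_eq_zero]
      ext s
      simp only [Set.mem_ofPred_eq, Set.mem_empty_iff_false, iff_false]
      rintro ⟨-, p, hp, hps⟩
      exact hn _ (sum_endpointCount s) p hps (subset_closure hp)
    rw [probDegreeDistributionMem_eq, h0, Nat.cast_zero, ENNReal.zero_div, ENNReal.log_zero]
    exact EReal.bot_div_of_pos_ne_top (by exact_mod_cast hn0) (EReal.coe_ne_top _)
  rw [limsup_congr hev, limsup_const]

end ZeroMean

end ERDegree

end

/-! ### The large deviation principle -/

theorem corollary2p3 (c : ℝ≥0) (m : ℕ → ℕ)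
    (hm : Tendsto (fun n : ℕ => 2 * (m n : ℝ) / (n : ℝ)) atTop (𝓝 (c : ℝ))) :
    LowerSemicontinuous (ERDegree.rate c) ∧
    ∀ Γ : Set (ProbabilityMeasure ℕ),
      -(⨅ p ∈ interior Γ, (ERDegree.rate c p : EReal)) ≤
          liminf (fun n : ℕ =>
            ENNReal.log (ERDegree.probDegreeDistributionMem n (m n) Γ) / ((n : ℝ) : EReal)) atTop ∧
      liminf (fun n : ℕ =>
            ENNReal.log (ERDegree.probDegreeDistributionMem n (m n) Γ) / ((n : ℝ) : EReal)) atTop ≤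
          limsup (fun n : ℕ =>
            ENNReal.log (ERDegree.probDegreeDistributionMem n (m n) Γ) / ((n : ℝ) : EReal)) atTop ∧
      limsup (fun n : ℕ =>
            ENNReal.log (ERDegree.probDegreeDistributionMem n (m n) Γ) / ((n : ℝ) : EReal)) atTop ≤
          -(⨅ p ∈ closure Γ, (ERDegree.rate c p : EReal)) := by
  refine ⟨ERDegree.lowerSemicontinuous_rate c, fun Γ => ⟨?_, liminf_le_limsup, ?_⟩⟩
  · rw [EReal.neg_le]
    refine le_iInf₂ fun p hp => ?_
    rw [EReal.neg_le]
    rcases eq_zero_or_pos c with rfl | hc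
    · by_cases h : p = ERDegree.diracZero
      · subst h
        rw [ERDegree.rate_zero_diracZero]
        simpa using ERDegree.le_liminf_of_zero (by simpa using hm) (mem_interior_iff_mem_nhds.1 hp)
      · simp [ERDegree.rate_zero_of_ne h]
    · exact ERDegree.neg_rate_le_liminf hc hm hp
  · rcases eq_zero_or_pos c with rfl | hc
    · by_cases h : ERDegree.diracZero ∈ closure Γ
      · refine (ERDegree.limsup_le_zero m Γ).trans ?_
        rw [EReal.le_neg, neg_zero]
        refine (iInf₂_le _ h).trans ?_
        simp [ERDegree.rate_zero_diracZero]
      · rw [ERDegree.limsup_eq_bot_of_zero (by simpa using hm) h]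
        exact bot_le
    · exact ERDegree.limsup_le_neg_iInf hc hm Γ
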